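/- **Model.** A two-stage causal MDP has a start state $0$ and intermediate states $1,\dots,k$. At every state $i\in\{0,\dots,k\}$ there are $n\ge 1$ independent Bernoulli variables $X^i_1,\dots,X^i_n\in\{0,1\}$ with $q^i_j=\mathbb P\{X^i_j=1\}$. The atomic interventions at a state are $do()$ and $do(X_j=x)$ for $j\in[n]$, $x\in\{0,1\}$; the latter sets $X_j$ to $x$ and leaves the other variables independent with their own distributions. There are $N=2n+1$ of them, and $\mathcal I_i$ is their set at state $i$. From state $0$ the process moves to a state $i\in[k]$ with a probability that depends on the values of $X^0_1,\dots,X^0_n$, and at state $i$ it receives a reward $R_i\in\{0,1\}$ whose distribution depends on the values of $X^i_1,\dots,X^i_n$; then it ends. Write $P_{(a,i)}=\mathbb P\{i\mid a\}$ for $a\in\mathcal I_0$, $i\in[k]$, and $p_+$ for the smallest nonzero entry of $P$. For a policy $\pi$ (an intervention $\pi(i)$ at each state $i\in\{0,\dots,k\}$), $\varepsilon(\pi)$ is the expected reward of an optimal policy minus $\sum_{i}P_{(\pi(0),i)}\,\mathbb E[R_i\mid \pi(i)]$. **Parameters.** For state $i$, sort the numbers $\min\{q^i_j,1-q^i_j\}$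 as $q^i_{(1)}\le\dots\le q^i_{(n)}$ and put $m_i=\max\{j : q^i_{(j)}<1/j\}$; $\mathcal I_{m_i}\subseteq\mathcal I_i$ consists of the $m_i$ interventions that set one of the first $m_i$ variables in this order to its less likely value. A frequency vector is an $f\in\mathbb R^{\mathcal I_0}$ with $f\ge 0$ and $\sum_a f_a=1$. With $M=\mathrm{diag}(m_1,\dots,m_k)$, $$\lambda=\min_{f}\Big\|PM^{1/2}(P^\top f)^{\circ-1/2}\Big\|_\infty^2=\min_f\ \max_{a\in\mathcal I_0}\Big(\sum_{i\in[k]}\frac{P_{(a,i)}\sqrt{m_i}}{\sqrt{(P^\top f)_i}}\Big)^2 ,$$ over frequency vectors $f$, with the conventions $1/\sqrt 0=\infty$ and $0\cdot\infty=0$. **Algorithm ALG-CE with budget $T$.** It knows $n,k,T$ only, and all estimates are empirical frequencies. Numbers of rounds are rounded down, and ties in the optimization problems are broken arbitrarily. 1. With $T'=T/3$ rounds: perform $do()$ at state $0$ for $T'/2$ rounds, and compute from them estimates $\hat q^0_j$, the resulting set $\widehat{\mathcal I}_{m_0}$, and $\widehat P_{(a,i)}$ for $a\in\mathcal I_0\setminus\widehat{\mathcal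 I}_{m_0}$, as the fraction of visits to $i$ among the rounds whose observed values agree with $a$. Then perform each $a\in\widehat{\mathcal I}_{m_0}$ for $T'/(2|\widehat{\mathcal I}_{m_0}|)$ rounds, and let $\widehat P_{(a,i)}$ be the fraction of visits to $i$ among these. 2. Let $\tilde f$ maximize $\min_{i\in[k]}(\widehat P^\top f)_i$ over frequency vectors. Perform each $a\in\mathcal I_0$ for $T'\cdot\frac12(\tilde f_a+\frac1N)$ rounds, with $do()$ at the intermediate states, and compute from these rounds estimates $\hat q^i_j$ and $\hat m_i$, $i\in[k]$; $\hat M=\mathrm{diag}(\hat m_1,\dots,\hat m_k)$. 3. Let $\hat f^*$ minimize $\max_{a\in\mathcal I_0}\big(\widehat P\hat M^{1/2}(\widehat P^\top f)^{\circ-1/2}\big)_a$ over frequency vectors, and put $f_a=\frac13(\hat f^*_a+\tilde f_a+\frac1N)$. Perform each $a\in\mathcal I_0$ for $f_aT'/2$ rounds, with $do()$ at the intermediate states; compute from these rounds new estimates of $q^i_j$, the sets $\widehat{\mathcal I}_{m_i}$, and the mean reward $\widehat{\mathcal R}_{(b,i)}$ for each $b\in\mathcal I_i\setminus\widehat{\mathcal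 I}_{m_i}$, over the visits to $i$ whose observed values agree with $b$. Then perform each $a\in\mathcal I_0$ for another $f_aT'/2$ rounds, performing at each state $i$ the interventions of $\widehat{\mathcal I}_{m_i}$ in round robin across its visits, and let $\widehat{\mathcal R}_{(b,i)}$, $b\in\widehat{\mathcal I}_{m_i}$, be the mean reward observed. 4. Return $\hat\pi$ with $\hat\pi(i)\in\arg\max_{b}\widehat{\mathcal R}_{(b,i)}$ for $i\in[k]$ and $\hat\pi(0)\in\arg\max_{a}\sum_i\widehat P_{(a,i)}\widehat{\mathcal R}_{(\hat\pi(i),i)}$. **Theorem.** There are absolute constants $C_0,C>0$ such that for every two-stage causal MDP as above and every integer $T\ge1$ with $$T\ \ge\ C_0\,\frac{N\max_{i\in[k]}m_i}{p_+^3}\,\log(2NT),$$ the policy $\hat\pi$ returned by ALG-CE with budget $T$ (for any way of breaking ties) satisfies $$\mathrm{Regret}_T=\mathbb E[\varepsilon(\hat\pi)]\ \le\ C\sqrt{\frac1T\max\Big\{\lambda,\frac{m_0}{p_+}\Big\}\log(NT)} .$$ -/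

import Mathlib

open scoped ENNReal Matrix

namespace CausalMDP

noncomputable section

/-! ### Two-stage causal MDPs with parallel causal graphs -/

/-- The atomic interventions on `n` Boolean variables: `none` is the empty intervention `do()`,
and `some (j, x)` is `do(X_j = x)`. There are `2 * n + 1` of them. -/
abbrev Intervention (n : ℕ) : Type := Option (Fin n × Bool)

/-- The Bernoulli distribution on `Bool` with success probability `p`. -/
def bern (p : unitInterval) : PMF Bool :=
  PMF.ofFintype (fun b => if b then ENNReal.ofReal p else ENNReal.ofReal (1 - p)) (by
    rw [Fintype.sum_bool]
    simp only [if_true, Bool.false_eq_true, if_false]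
    rw [← ENNReal.ofReal_add p.2.1 (sub_nonneg.2 p.2.2)]
    simp)

/-- The joint distribution of independent Boolean variables with the given marginals. -/
def indep {n : ℕ} (μ : Fin n → PMF Bool) : PMF (Fin n → Bool) :=
  PMF.ofFintype (fun x => ∏ j, μ j (x j)) (by
    have h := (Fintype.prod_sum (fun (j : Fin n) (b : Bool) => μ j b)).symm
    rw [h]
    refine Finset.prod_eq_one fun j _ => ?_
    exact (tsum_fintype (fun b => μ j b)).symm.trans (μ j).tsum_coe)

/-- The joint distribution of the variables of a parallel graph under an intervention: the
intervened variable is set to its value, and all the others stay independent Bernoulli. -/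
def varLaw {n : ℕ} (q : Fin n → unitInterval) (a : Intervention n) : PMF (Fin n → Bool) :=
  indep fun j =>
    if a = some (j, true) then PMF.pure true
    else if a = some (j, false) then PMF.pure false
    else bern (q j)

/-- A two-stage causal MDP with start state `0`, intermediate states `Fin k`, and `n` independent
Bernoulli variables at each of these states. -/
structure Model (n k : ℕ) where
  /-- `q₀ j` is the probability of `X_j = 1` at the start state. -/
  q₀ : Fin n → unitInterval
  /-- `q i j` is the probability of `X_j = 1` at the intermediate state `i`. -/
  q : Fin k → Fin n → unitInterval
  /-- the law of the intermediate state, given the values of the variables at the start state -/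
  trans : (Fin n → Bool) → PMF (Fin k)
  /-- the probability of reward `1` at an intermediate state, given the values of its variables -/
  rew : Fin k → (Fin n → Bool) → unitInterval

/-- A policy: an intervention at the start state and one at every intermediate state. -/
abbrev Policy (n k : ℕ) : Type := Intervention n × (Fin k → Intervention n)

/-! ### Causal parameters -/

/-- The probability of the less likely value of each variable. -/
def minProb {n : ℕ} (q : Fin n → ℝ) (j : Fin n) : ℝ := min (q j) (1 - q j)

/-- The less likely value of each variable (`1` if both are equally likely). -/
def rareVal {n : ℕ} (q : Fin n → ℝ) (j : Fin n) : Bool := decide (q j ≤ 1 - q j)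

/-- The variables in increasing order of `minProb`. -/
def order {n : ℕ} (q : Fin n → ℝ) : Equiv.Perm (Fin n) := Tuple.sort (minProb q)

/-- The causal parameter `m = max {j | q_(j) < 1 / j}`, where `q_(1) ≤ … ≤ q_(n)` are the
probabilities of the less likely values in increasing order. (Positions count from `0` here.) -/
def causalParam {n : ℕ} (q : Fin n → ℝ) : ℕ :=
  (Finset.univ.filter fun j : Fin n => minProb q (order q j) < 1 / ((j : ℝ) + 1)).sup
    fun j => (j : ℕ) + 1

/-- The `m` interventions that set one of the first `m` variables, in increasing order of
`minProb`, to its less likely value. -/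
def rareInterventions {n : ℕ} (q : Fin n → ℝ) : List (Intervention n) :=
  ((List.finRange n).take (causalParam q)).map fun j =>
    some (order q j, rareVal q (order q j))

/-- For transition probabilities `P`, causal parameters `m` and a frequency vector `f`, the norm
`‖P M^{1/2} (Pᵀ f)^{∘ -1/2}‖_∞`, where `M = diag m`. Arithmetic in `[0, ∞]`: `0 ^ (-1/2) = ∞`
and `0 * ∞ = 0`, so that states of probability zero do not count. -/
def exploreCost {n k : ℕ} (P : Matrix (Intervention n) (Fin k) ℝ) (m : Fin k → ℕ)
    (f : Intervention n → ℝ) : ℝ≥0∞ :=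
  ⨆ a, ∑ i, ENNReal.ofReal (P a i * √(m i)) * ENNReal.ofReal ((Pᵀ *ᵥ f) i) ^ (-(1 / 2) : ℝ)

namespace Model

variable {n k : ℕ} (M : Model n k)

/-- The law of the intermediate state under an intervention at the start state. -/
def stateLaw (a : Intervention n) : PMF (Fin k) := (varLaw M.q₀ a).bind M.trans

/-- The transition matrix `P_(a,i) = ℙ{i | a}`. -/
def P : Matrix (Intervention n) (Fin k) ℝ := Matrix.of fun a i => (M.stateLaw a i).toReal

/-- The expected reward `𝔼[R_i | b]`. -/
def meanReward (i : Fin k) (b : Intervention n) : ℝ :=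
  ∑ y, (varLaw (M.q i) b y).toReal * M.rew i y

/-- The expected reward of a policy. -/
def value (π : Policy n k) : ℝ := ∑ i, M.P π.1 i * M.meanReward i (π.2 i)

/-- The expected reward of an optimal policy: it maximizes the expected reward at each intermediate
state, and then the resulting expected reward at the start state. -/
def optValue : ℝ := ⨆ a, ∑ i, M.P a i * ⨆ b, M.meanReward i b

/-- The sub-optimality of a policy. -/
def subopt (π : Policy n k) : ℝ := M.optValue - M.value π

/-- The smallest nonzero transition probability. -/
def pPlus : ℝ := sInf {p : ℝ | 0 < p ∧ ∃ a i, M.P a i = p}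

/-- The causal parameter at the start state. -/
def m₀ : ℕ := causalParam fun j => (M.q₀ j : ℝ)

/-- The causal parameters at the intermediate states. -/
def m (i : Fin k) : ℕ := causalParam fun j => (M.q i j : ℝ)

/-- `λ`, the least value of `‖P M^{1/2} (Pᵀ f)^{∘ -1/2}‖_∞ ^ 2` over the frequency vectors `f`. -/
def lam : ℝ := (⨅ f ∈ stdSimplex ℝ (Intervention n), exploreCost M.P M.m f ^ 2).toReal

end Model

/-! ### Interaction with the MDP -/

/-- What is done and seen in one round: the intervention at the start state, the values of the
variables there, the intermediate state, the intervention and the values of the variables there,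
and the reward. -/
structure Round (n k : ℕ) where
  act₀ : Intervention n
  x₀ : Fin n → Bool
  state : Fin k
  act : Intervention n
  x : Fin n → Bool
  reward : Bool

/-- One round, with intervention `a` at the start state and `b i` at the intermediate state `i`. -/
def Model.round {n k : ℕ} (M : Model n k) (a : Intervention n) (b : Fin k → Intervention n) :
    PMF (Round n k) :=
  (varLaw M.q₀ a).bind fun x₀ =>
    (M.trans x₀).bind fun i =>
      (varLaw (M.q i) (b i)).bind fun x =>
        (bern (M.rew i x)).bind fun r =>
          PMF.pure ⟨a, x₀, i, b i, x, r⟩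

/-- Successive rounds with the listed interventions at the start state. The interventions at the
intermediate states are chosen by `rule` from the rounds played before. The list of the rounds that
have been played has the last one first. -/
def Model.play {n k : ℕ} (M : Model n k)
    (rule : List (Round n k) → Fin k → Intervention n) :
    List (Intervention n) → List (Round n k) → PMF (List (Round n k))
  | [], h => PMF.pure h
  | a :: as, h => (M.round a (rule h)).bind fun r => M.play rule as (r :: h)

/-- The rule that performs `do()` at every intermediate state. -/
def doNothing {n k : ℕ} : List (Round n k) → Fin k → Intervention n := fun _ _ => none

/-- The rule that performs, at each state `i`, the interventions of the list `L i` in turn across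
the visits of `i`. -/
def roundRobin {n k : ℕ} (L : Fin k → List (Intervention n)) :
    List (Round n k) → Fin k → Intervention n :=
  fun h i => (L i).getD ((h.countP fun r => r.state = i) % (L i).length) none

/-! ### Empirical estimates -/

/-- The fraction of those entries of `h` that satisfy `c` which satisfy `e` as well
(`0` if no entry satisfies `c`). -/
def freq {α : Type} (h : List α) (c e : α → Prop) [DecidablePred c] [DecidablePred e] : ℝ :=
  (h.countP fun r => c r ∧ e r : ℕ) / (h.countP fun r => c r : ℕ)

/-- The observed values agree with what the intervention sets. -/
def Agrees {n : ℕ} (a : Intervention n) (x : Fin n → Bool) : Prop := ∀ p ∈ a, x p.1 = p.2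

instance {n : ℕ} (a : Intervention n) (x : Fin n → Bool) : Decidable (Agrees a x) :=
  inferInstanceAs (Decidable (∀ p ∈ a, x p.1 = p.2))

/-- Estimates of the `q_j` at the start state. -/
def qHat₀ {n k : ℕ} (h : List (Round n k)) (j : Fin n) : ℝ :=
  freq h (fun _ => True) (fun r => r.x₀ j = true)

/-- Estimates of the `q_j` at the intermediate states. -/
def qHat {n k : ℕ} (h : List (Round n k)) (i : Fin k) (j : Fin n) : ℝ :=
  freq h (fun r => r.state = i) (fun r => r.x j = true)

/-! ### The convex-exploration algorithm -/

/-- A choice of solutions of the three kinds of optimization problems that the algorithm solves: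
the choice is arbitrary where there is more than one solution. -/
structure Solver (n k : ℕ) where
  maxmin : Matrix (Intervention n) (Fin k) ℝ → Intervention n → ℝ
  maxmin_mem : ∀ P, maxmin P ∈ stdSimplex ℝ (Intervention n)
  maxmin_opt : ∀ P, ∀ f ∈ stdSimplex ℝ (Intervention n),
    ⨅ i, (Pᵀ *ᵥ f) i ≤ ⨅ i, (Pᵀ *ᵥ maxmin P) i
  minmax : Matrix (Intervention n) (Fin k) ℝ → (Fin k → ℕ) → Intervention n → ℝ
  minmax_mem : ∀ P m, minmax P m ∈ stdSimplex ℝ (Intervention n)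
  minmax_opt : ∀ P m, ∀ f ∈ stdSimplex ℝ (Intervention n),
    exploreCost P m (minmax P m) ≤ exploreCost P m f
  argmax : (Intervention n → ℝ) → Intervention n
  argmax_opt : ∀ (v : Intervention n → ℝ) (a : Intervention n), v a ≤ v (argmax v)

/-- Solutions of these optimization problems always exist. -/
theorem Solver.nonempty (n k : ℕ) : Nonempty (Solver n k) := by
  have hc : IsCompact (stdSimplex ℝ (Intervention n)) := isCompact_stdSimplex ℝ _
  have hne : (stdSimplex ℝ (Intervention n)).Nonempty :=
    ⟨Pi.single none 1, single_mem_stdSimplex ℝ _⟩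
  have hlin : ∀ (P : Matrix (Intervention n) (Fin k) ℝ) (i : Fin k),
      Continuous fun f : Intervention n → ℝ => (Pᵀ *ᵥ f) i := by
    intro P i
    simp only [Matrix.mulVec, dotProduct]
    fun_prop
  have h1 : ∀ P : Matrix (Intervention n) (Fin k) ℝ, ∃ f ∈ stdSimplex ℝ (Intervention n),
      ∀ g ∈ stdSimplex ℝ (Intervention n), ⨅ i, (Pᵀ *ᵥ g) i ≤ ⨅ i, (Pᵀ *ᵥ f) i := by
    intro P
    rcases isEmpty_or_nonempty (Fin k) with hk | hk
    · obtain ⟨f, hf⟩ := hne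
      exact ⟨f, hf, fun g _ => by simp [Real.iInf_of_isEmpty]⟩
    · have hcont : Continuous fun f : Intervention n → ℝ => ⨅ i, (Pᵀ *ᵥ f) i := by
        have : (fun f : Intervention n → ℝ => ⨅ i, (Pᵀ *ᵥ f) i) =
            fun f => Finset.univ.inf' Finset.univ_nonempty fun i => (Pᵀ *ᵥ f) i := by
          funext f
          rw [Finset.inf'_univ_eq_ciInf]
        rw [this]
        exact Continuous.finset_inf'_apply _ fun i _ => hlin P i
      obtain ⟨f, hf, hm⟩ := hc.exists_isMaxOn hne hcont.continuousOn
      exact ⟨f, hf, fun g hg => hm hg⟩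
  have h2 : ∀ (P : Matrix (Intervention n) (Fin k) ℝ) (m : Fin k → ℕ),
      ∃ f ∈ stdSimplex ℝ (Intervention n), ∀ g ∈ stdSimplex ℝ (Intervention n),
        exploreCost P m f ≤ exploreCost P m g := by
    intro P m
    have hcont : Continuous fun f : Intervention n → ℝ => exploreCost P m f := by
      have : (fun f : Intervention n → ℝ => exploreCost P m f) =
          fun f => Finset.univ.sup fun a => ∑ i, ENNReal.ofReal (P a i * √(m i)) *
            ENNReal.ofReal ((Pᵀ *ᵥ f) i) ^ (-(1 / 2) : ℝ) := by
        funext f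
        rw [Finset.sup_univ_eq_iSup]
        rfl
      rw [this]
      refine Continuous.finset_sup_apply fun a _ => continuous_finsetSum _ fun i _ => ?_
      refine (ENNReal.continuous_const_mul ENNReal.ofReal_ne_top).comp ?_
      exact ENNReal.continuous_rpow_const.comp (ENNReal.continuous_ofReal.comp (hlin P i))
    obtain ⟨f, hf, hm⟩ := hc.exists_isMinOn hne hcont.continuousOn
    exact ⟨f, hf, fun g hg => hm hg⟩
  have h3 : ∀ v : Intervention n → ℝ, ∃ a, ∀ b, v b ≤ v a := fun v => Finite.exists_max v
  choose f₁ hf₁ hf₁' using h1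
  choose f₂ hf₂ hf₂' using h2
  choose g hg using h3
  exact ⟨⟨f₁, hf₁, hf₁', f₂, hf₂, hf₂', g, hg⟩⟩

/-- The estimate of the transition matrix from the `do()`-rounds `h` and the rounds `h'` in which the
interventions of the list `L` were performed. -/
def pHat {n k : ℕ} (L : List (Intervention n)) (h h' : List (Round n k)) :
    Matrix (Intervention n) (Fin k) ℝ :=
  Matrix.of fun a i =>
    if a ∈ L then freq h' (fun r => r.act₀ = a) (fun r => r.state = i)
    else freq h (fun r => Agrees a r.x₀) (fun r => r.state = i)

/-- First subroutine, with `T'` rounds: estimation of the transition probabilities. -/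
def estimateTransitions {n k : ℕ} (M : Model n k) (T' : ℕ) :
    PMF (Matrix (Intervention n) (Fin k) ℝ) :=
  (M.play doNothing (List.replicate (T' / 2) none) []).bind fun h =>
    let L := rareInterventions (qHat₀ h)
    (M.play doNothing (L.flatMap fun a => List.replicate (T' / (2 * L.length)) a) []).bind fun h' =>
      PMF.pure (pHat L h h')

/-- The schedule that performs each intervention `a` for `⌊t a⌋` rounds. -/
def schedule {n : ℕ} (t : Intervention n → ℝ) : List (Intervention n) :=
  Finset.univ.toList.flatMap fun a => List.replicate ⌊t a⌋₊ a

/-- Second subroutine, with frequency vector `ft` and `T'` rounds: estimation of the causal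
parameters. -/
def estimateCausalParams {n k : ℕ} (M : Model n k) (ft : Intervention n → ℝ) (T' : ℕ) :
    PMF (Fin k → ℕ) :=
  let f : Intervention n → ℝ := fun a => (1 / 2) * (ft a + 1 / (2 * n + 1))
  (M.play doNothing (schedule fun a => T' * f a) []).bind fun h =>
    PMF.pure fun i => causalParam (qHat h i)

/-- The estimates of the mean rewards from the rounds `h` with `do()` at the intermediate states and
the rounds `h'` in which the interventions of the list `L i` were performed at state `i`. -/
def rHat {n k : ℕ} (L : Fin k → List (Intervention n)) (h h' : List (Round n k))
    (i : Fin k) (b : Intervention n) : ℝ :=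
  if b ∈ L i then freq h' (fun r => r.state = i ∧ r.act = b) (fun r => r.reward = true)
  else freq h (fun r => r.state = i ∧ Agrees b r.x) (fun r => r.reward = true)

/-- Third subroutine, with frequency vectors `fs`, `ft` and `T'` rounds: estimation of the mean
rewards. -/
def estimateRewards {n k : ℕ} (M : Model n k) (fs ft : Intervention n → ℝ) (T' : ℕ) :
    PMF (Fin k → Intervention n → ℝ) :=
  let f : Intervention n → ℝ := fun a => (1 / 3) * (fs a + ft a + 1 / (2 * n + 1))
  let acts := schedule fun a => f a * T' / 2
  (M.play doNothing acts []).bind fun h =>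
    let L : Fin k → List (Intervention n) := fun i => rareInterventions (qHat h i)
    (M.play (roundRobin L) acts []).bind fun h' =>
      PMF.pure (rHat L h h')

/-- The convex-exploration algorithm with a budget of `T` rounds: the law of its policy. -/
def algCE {n k : ℕ} (M : Model n k) (S : Solver n k) (T : ℕ) : PMF (Policy n k) :=
  (estimateTransitions M (T / 3)).bind fun P' =>
    let ft := S.maxmin P'
    (estimateCausalParams M ft (T / 3)).bind fun m' =>
      let fs := S.minmax P' m'
      (estimateRewards M fs ft (T / 3)).bind fun R' =>
        let π : Fin k → Intervention n := fun i => S.argmax (R' i)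
        PMF.pure (S.argmax fun a => ∑ i, P' a i * R' i (π i), π)

/-- The expected simple regret of the algorithm with a budget of `T` rounds. -/
def regret {n k : ℕ} (M : Model n k) (S : Solver n k) (T : ℕ) : ℝ :=
  ∑ π, (algCE M S T π).toReal * M.subopt π

end

end CausalMDP

namespace CausalMDP

noncomputable section

/-! ### Expectations and probabilities for `PMF` -/

/-! With probability at least `1 - 55/T` every estimate of the algorithm has its typical size of
error. On that event the returned policy, greedy for the estimates, loses at most twice the error of
the estimated values; off it, it loses at most 1, which the rate absorbs.

Every estimate is a ratio of two counts: rounds satisfying `c` and `e` over rounds satisfying `c`.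
The denominator is random and the rounds may depend on the past. What is needed of a single round is
`CondBern`: given `c`, the event `e` has a fixed probability `p`. For observations under `do()` this
holds because the variables are independent, so that conditioning on a value is the same as
intervening (`varLaw_none_mul`). An exponential supermartingale and Markov's inequality then bound
the deviation for one exponent (`play_deviation`), and a union bound over the exponents suited to
every possible denominator gives `Conc` (`play_conc`). The number of states `k` is unbounded, so
union bounds run only over states of positive probability, of which there are at most `N T`
(`Budget.card_reach_le`).

Sample sizes come from the causal parameters. An intervention outside the rare set agrees with a
fraction at least `1/(m + 1)` of the observations, and the `m` rare ones are performed explicitly;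
so every intervention gets a share of order `1/m`. Estimated parameters are within constant factors
of the true ones (`causalParam_freq`).

The error then has two sources. Transition estimates err by order `√(P m₀ log(NT) / T)` entrywise;
as `√P ≤ P / √p₊` at nonzero entries, summing a row gives `√(m₀ log(NT) / (p₊ T))`. Reward estimates
at state `i` err by order `√(mᵢ log(NT) / (T (Pᵀf)ᵢ))`; weighted by a row of `P`, these sum to at
most the exploration cost of `f` times `√(log(NT) / T)`. The frequencies `f` minimize the estimated
cost up to a factor 3 from mixing, and the estimated cost is equivalent to the true one
(`exploreCost_le`), so the squared cost is at most `6912 λ` (`exploreCost_mixFreq_le`,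
`sum_div_sqrt_le`). `subopt_le_of_estimates` combines the two errors. -/

/-- The expectation of an extended nonnegative function. -/
def mean {α : Type*} (p : PMF α) (F : α → ℝ≥0∞) : ℝ≥0∞ := ∑' x, p x * F x

theorem mean_pure {α : Type*} (x : α) (F : α → ℝ≥0∞) : mean (PMF.pure x) F = F x := by
  classical
  unfold mean
  rw [tsum_eq_single x fun y hy => by simp [PMF.pure_apply, hy]]
  simp

theorem mean_bind {α β : Type*} (p : PMF α) (g : α → PMF β) (F : β → ℝ≥0∞) :
    mean (p.bind g) F = mean p fun x => mean (g x) F := by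
  simp only [mean, PMF.bind_apply, ← ENNReal.tsum_mul_left, ← ENNReal.tsum_mul_right]
  rw [ENNReal.tsum_comm]
  simp only [mul_assoc]

theorem mean_mono {α : Type*} {p : PMF α} {F G : α → ℝ≥0∞}
    (h : ∀ x ∈ p.support, F x ≤ G x) : mean p F ≤ mean p G := by
  refine ENNReal.tsum_le_tsum fun x => ?_
  by_cases hx : p x = 0
  · simp [hx]
  · exact mul_le_mul_right (h x hx) _

theorem mean_const {α : Type*} (p : PMF α) (c : ℝ≥0∞) : mean p (fun _ => c) = c := by
  simp [mean, ENNReal.tsum_mul_right]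

theorem mean_const_mul {α : Type*} (p : PMF α) (c : ℝ≥0∞) (F : α → ℝ≥0∞) :
    mean p (fun x => c * F x) = c * mean p F := by
  simp only [mean, ← ENNReal.tsum_mul_left]
  exact tsum_congr fun x => by ring

theorem toOuterMeasure_eq_mean {α : Type*} (p : PMF α) (S : Set α) :
    p.toOuterMeasure S = mean p (S.indicator 1) := by
  rw [PMF.toOuterMeasure_apply]
  refine tsum_congr fun x => ?_
  by_cases hx : x ∈ S <;> simp [hx]

theorem toOuterMeasure_le_one {α : Type*} (p : PMF α) (S : Set α) : p.toOuterMeasure S ≤ 1 := by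
  rw [toOuterMeasure_eq_mean, ← mean_const p 1]
  exact mean_mono fun x _ => Set.indicator_le_self' (fun _ _ => zero_le) x

theorem toOuterMeasure_bind_le {α β : Type*} (p : PMF α) (g : α → PMF β) (A : Set α) (S : Set β)
    {δ : ℝ≥0∞} (h : ∀ x ∈ p.support, x ∉ A → (g x).toOuterMeasure S ≤ δ) :
    (p.bind g).toOuterMeasure S ≤ p.toOuterMeasure A + δ := by
  rw [toOuterMeasure_eq_mean, mean_bind, toOuterMeasure_eq_mean]
  calc _ ≤ mean p (fun x => A.indicator 1 x + δ) := by
        refine mean_mono fun x hx => ?_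
        rw [← toOuterMeasure_eq_mean]
        by_cases hA : x ∈ A
        · simpa [hA] using (toOuterMeasure_le_one _ _).trans (le_add_right le_rfl)
        · simpa [hA] using h x hx hA
    _ = _ := by
        conv_rhs => rw [← mean_const p δ]
        simp only [mean, mul_add]
        exact ENNReal.tsum_add

theorem toOuterMeasure_pure_eq_zero {α : Type*} {x : α} {S : Set α} (h : x ∉ S) :
    (PMF.pure x).toOuterMeasure S = 0 := by
  classical
  rw [toOuterMeasure_eq_mean, mean_pure]
  simp [h]

/-- Given `c`, the event `e` has conditional probability `p`, in the form of an inequality between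
expectations. -/
def CondBern {α : Type*} (ρ : PMF α) (c e : α → Prop) [DecidablePred c] [DecidablePred e]
    (p : ℝ) : Prop :=
  ∀ u v : ℝ≥0∞, ENNReal.ofReal p * u + ENNReal.ofReal (1 - p) * v ≤ 1 →
    mean ρ (fun r => if c r then if e r then u else v else 1) ≤ 1

theorem CondBern.ne_zero {α : Type*} {ρ : PMF α} {c e : α → Prop} [DecidablePred c]
    [DecidablePred e] {p : ℝ} (h : CondBern ρ c e p) {r : α} (hr : r ∈ ρ.support)
    (hc : c r) (he : e r) : p ≠ 0 := by
  rintro rfl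
  -- The weights may be infinite: if `p = 0`, the weight `⊤` on `e` is admissible because `0 * ⊤ =
  -- 0`, and a finite mean leaves no mass there.
  have h1 := h ⊤ 1 (by simp)
  have h2 : (⊤ : ℝ≥0∞) ≤ 1 := by
    refine le_trans ?_ h1
    refine le_trans ?_ (ENNReal.le_tsum r)
    simp [hc, he, ENNReal.mul_top hr]
  simp at h2

theorem mean_ite {α : Type*} (ρ : PMF α) (e : α → Prop) [DecidablePred e] (u v : ℝ≥0∞) :
    mean ρ (fun r => if e r then u else v) =
      ρ.toOuterMeasure {r | e r} * u + (1 - ρ.toOuterMeasure {r | e r}) * v := by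
  have h1 : ∀ s : ℝ≥0∞, mean ρ (fun r => if e r then s else 0) =
      s * ρ.toOuterMeasure {r | e r} := fun s => by
    rw [toOuterMeasure_eq_mean, ← mean_const_mul]
    congr 1; ext r; by_cases he : e r <;> simp [he]
  have h2 : ∀ s : ℝ≥0∞, mean ρ (fun r => if e r then 0 else s) =
      s * ρ.toOuterMeasure {r | ¬ e r} := fun s => by
    rw [toOuterMeasure_eq_mean, ← mean_const_mul]
    congr 1; ext r; by_cases he : e r <;> simp [he]
  have h3 : ∀ s t : ℝ≥0∞, mean ρ (fun r => if e r then s else t) =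
      mean ρ (fun r => if e r then s else 0) + mean ρ (fun r => if e r then 0 else t) := by
    intro s t
    simp only [mean]
    rw [← ENNReal.tsum_add]
    refine tsum_congr fun r => ?_
    by_cases he : e r <;> simp [he]
  have h4 : ρ.toOuterMeasure {r | e r} + ρ.toOuterMeasure {r | ¬ e r} = 1 := by
    have := h3 1 1
    rw [h1, h2] at this
    simpa [mean_const] using this.symm
  rw [h3, h1, h2]
  have h5 : 1 - ρ.toOuterMeasure {r | e r} = ρ.toOuterMeasure {r | ¬ e r} := by
    rw [← h4]
    exact ENNReal.add_sub_cancel_left (ne_top_of_le_ne_top ENNReal.one_ne_top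
      (toOuterMeasure_le_one _ _))
  rw [h5]; ring

theorem mean_ite_le_one {α : Type*} {ρ : PMF α} {e : α → Prop} [DecidablePred e] {p : ℝ}
    (hp : 0 ≤ p) (h : ρ.toOuterMeasure {r | e r} = ENNReal.ofReal p) {u v : ℝ≥0∞}
    (huv : ENNReal.ofReal p * u + ENNReal.ofReal (1 - p) * v ≤ 1) :
    mean ρ (fun r => if e r then u else v) ≤ 1 := by
  rw [mean_ite, h]
  rwa [ENNReal.ofReal_sub _ hp, ENNReal.ofReal_one] at huv

/-! ### The laws of the variables -/

theorem bern_true (p : unitInterval) : bern p true = ENNReal.ofReal p := by simp [bern]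

theorem bern_false (p : unitInterval) : bern p false = ENNReal.ofReal (1 - p) := by simp [bern]

/-- The probability that a variable with mean `q` takes the value `x`. -/
def valProb (q : ℝ) (x : Bool) : ℝ := if x then q else 1 - q

theorem bern_eq (q : unitInterval) (x : Bool) : bern q x = ENNReal.ofReal (valProb q x) := by
  cases x <;> simp [bern_true, bern_false, valProb]

theorem valProb_nonneg (q : unitInterval) (x : Bool) : 0 ≤ valProb q x := by
  cases x <;> simp [valProb, q.2.1, q.2.2]

theorem valProb_le_one (q : unitInterval) (x : Bool) : valProb q x ≤ 1 := by
  cases x <;> simp [valProb, q.2.1, q.2.2]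

/-- By independence, conditioning on a value and intervening give the same law. The product form
avoids dividing by a probability that may vanish. -/
theorem varLaw_none_mul {n : ℕ} (q : Fin n → unitInterval) (j : Fin n) (y : Bool)
    (x : Fin n → Bool) :
    (if x j = y then varLaw q none x else 0) =
      ENNReal.ofReal (valProb (q j) y) * varLaw q (some (j, y)) x := by
  simp only [varLaw, indep, PMF.ofFintype_apply]
  rw [← Finset.mul_prod_erase _ _ (Finset.mem_univ j), ← Finset.mul_prod_erase _ _ (Finset.mem_univ j)]
  have h : ∀ l ∈ Finset.univ.erase j, (if (some (j, y) : Intervention n) = some (l, true) then PMF.pure true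
      else if (some (j, y) : Intervention n) = some (l, false) then PMF.pure false else bern (q l)) (x l)
      = bern (q l) (x l) := by
    intro l hl
    have : j ≠ l := (Finset.ne_of_mem_erase hl).symm
    simp [this]
  rw [Finset.prod_congr rfl h]
  rw [← bern_eq]
  by_cases hx : x j = y
  · subst hx
    cases hxj : x j <;> simp [PMF.pure_apply]
  · cases hy : y <;> cases hxj : x j <;> simp_all [PMF.pure_apply]

theorem varLaw_none_agrees {n : ℕ} (q : Fin n → unitInterval) (b : Intervention n) :
    ∃ t : ℝ≥0∞, t ≠ ⊤ ∧ ∀ x, (if Agrees b x then varLaw q none x else 0) = t * varLaw q b x := by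
  rcases b with _ | ⟨j, y⟩
  · exact ⟨1, by simp, fun x => by simp [Agrees]⟩
  · refine ⟨ENNReal.ofReal (valProb (q j) y), ENNReal.ofReal_ne_top, fun x => ?_⟩
    rw [← varLaw_none_mul]
    simp [Agrees]

theorem mean_varLaw_none_agrees {n : ℕ} (q : Fin n → unitInterval) (b : Intervention n)
    (G : (Fin n → Bool) → ℝ≥0∞) (hG : mean (varLaw q b) G ≤ 1) :
    mean (varLaw q none) (fun x => if Agrees b x then G x else 1) ≤ 1 := by
  obtain ⟨t, -, ht⟩ := varLaw_none_agrees q b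
  have h : ∀ F : (Fin n → Bool) → ℝ≥0∞,
      mean (varLaw q none) (fun x => if Agrees b x then F x else 1) =
        t * mean (varLaw q b) F + ∑' x, if Agrees b x then 0 else varLaw q none x := by
    intro F
    simp only [mean]
    rw [← ENNReal.tsum_mul_left, ← ENNReal.tsum_add]
    refine tsum_congr fun x => ?_
    rw [← mul_assoc, ← ht]
    by_cases hx : Agrees b x <;> simp [hx]
  -- For the constant function 1 the same decomposition says that the two masses add up to 1.
  have h1 := h fun _ => 1
  rw [h]
  simp only [ite_self, mean_const] at h1
  rw [h1]
  gcongr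

theorem varLaw_none_prob {n : ℕ} (q : Fin n → unitInterval) (j : Fin n) (y : Bool) :
    (varLaw q none).toOuterMeasure {x | x j = y} = ENNReal.ofReal (valProb (q j) y) := by
  rw [PMF.toOuterMeasure_apply]
  have : ∀ x, Set.indicator {x : Fin n → Bool | x j = y} (varLaw q none) x =
      ENNReal.ofReal (valProb (q j) y) * varLaw q (some (j, y)) x := by
    intro x
    rw [← varLaw_none_mul]
    simp [Set.indicator]
  simp only [this, ENNReal.tsum_mul_left, PMF.tsum_coe, mul_one]

/-! ### The conditional laws within one round -/

namespace Model

variable {n k : ℕ} (M : Model n k)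

theorem mean_round (a : Intervention n) (β : Fin k → Intervention n) (F : Round n k → ℝ≥0∞) :
    mean (M.round a β) F =
      mean (varLaw M.q₀ a) fun x₀ => mean (M.trans x₀) fun i =>
        mean (varLaw (M.q i) (β i)) fun x => mean (bern (M.rew i x)) fun r =>
          F ⟨a, x₀, i, β i, x, r⟩ := by
  simp only [Model.round, mean_bind, mean_pure]

theorem mean_round_eq (a : Intervention n) (β : Fin k → Intervention n) {F : Round n k → ℝ≥0∞}
    (G : (Fin n → Bool) → Fin k → (Fin n → Bool) → ℝ≥0∞)
    (h : ∀ x₀ i x r, F ⟨a, x₀, i, β i, x, r⟩ = G x₀ i x) :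
    mean (M.round a β) F =
      mean (varLaw M.q₀ a) fun x₀ => mean (M.trans x₀) fun i =>
        mean (varLaw (M.q i) (β i)) fun x => G x₀ i x := by
  simp only [mean_round, h, mean_const]

theorem mem_support_round {a : Intervention n} {β : Fin k → Intervention n} {r : Round n k}
    (hr : r ∈ (M.round a β).support) : r.act₀ = a ∧ r.act = β r.state := by
  simp only [Model.round, PMF.mem_support_bind_iff, PMF.support_pure, Set.mem_singleton_iff] at hr
  obtain ⟨x₀, -, i, -, x, -, b, -, rfl⟩ := hr
  simp

theorem P_nonneg (a : Intervention n) (i : Fin k) : 0 ≤ M.P a i := ENNReal.toReal_nonneg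

theorem sum_P (a : Intervention n) : ∑ i, M.P a i = 1 := by
  have h : ∑ i, M.stateLaw a i = 1 := (tsum_fintype (fun i => M.stateLaw a i)).symm.trans (PMF.tsum_coe _)
  simp only [P, Matrix.of_apply]
  rw [← ENNReal.toReal_sum fun i _ => PMF.apply_ne_top _ _, h, ENNReal.toReal_one]

theorem P_le_one (a : Intervention n) (i : Fin k) : M.P a i ≤ 1 := by
  rw [← M.sum_P a]
  exact Finset.single_le_sum (fun i _ => M.P_nonneg a i) (Finset.mem_univ i)

theorem stateLaw_prob (a : Intervention n) (i : Fin k) :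
    (M.stateLaw a).toOuterMeasure {l | l = i} = ENNReal.ofReal (M.P a i) := by
  have : {l | l = i} = {i} := rfl
  rw [this, PMF.toOuterMeasure_apply_singleton, P, Matrix.of_apply,
    ENNReal.ofReal_toReal (PMF.apply_ne_top _ _)]

theorem mean_stateLaw_le {a : Intervention n} {i : Fin k} {u v : ℝ≥0∞}
    (huv : ENNReal.ofReal (M.P a i) * u + ENNReal.ofReal (1 - M.P a i) * v ≤ 1) :
    mean (varLaw M.q₀ a) (fun x => mean (M.trans x) fun l => if l = i then u else v) ≤ 1 := by
  rw [← mean_bind]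
  exact mean_ite_le_one (M.P_nonneg a i) (M.stateLaw_prob a i) huv

theorem condBern_state (a a' : Intervention n) (i : Fin k) (β : Fin k → Intervention n) :
    CondBern (M.round a' β) (fun r => r.act₀ = a) (fun r => r.state = i) (M.P a i) := by
  intro u v huv
  rw [M.mean_round_eq _ _ (fun _ l _ => if a' = a then if l = i then u else v else 1)
    fun _ _ _ _ => rfl]
  by_cases h : a' = a
  · subst h
    simpa [mean_const] using M.mean_stateLaw_le huv
  · simp [h, mean_const]

/-- Makes a `do()` round usable as a sample for every intervention that its observed values agree
with; `condBern_reward_of_agrees` is the counterpart at intermediate states. -/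
theorem condBern_state_of_agrees (a : Intervention n) (i : Fin k) (β : Fin k → Intervention n) :
    CondBern (M.round none β) (fun r => Agrees a r.x₀) (fun r => r.state = i) (M.P a i) := by
  intro u v huv
  rw [M.mean_round_eq _ _ (fun x₀ l _ => if Agrees a x₀ then if l = i then u else v else 1)
    fun _ _ _ _ => rfl]
  have := mean_varLaw_none_agrees M.q₀ a _ (M.mean_stateLaw_le huv)
  refine le_of_eq_of_le ?_ this
  congr 1; ext x
  by_cases h : Agrees a x <;> simp [h, mean_const]

theorem condBern_x₀ (j : Fin n) (y : Bool) (β : Fin k → Intervention n) :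
    CondBern (M.round none β) (fun _ => True) (fun r => r.x₀ j = y)
      (valProb (M.q₀ j) y) := by
  intro u v huv
  rw [M.mean_round_eq _ _ (fun x₀ _ _ => if x₀ j = y then u else v)
    fun _ _ _ _ => by simp]
  simpa [mean_const] using mean_ite_le_one (valProb_nonneg _ _) (varLaw_none_prob M.q₀ j y) huv

theorem condBern_x (a : Intervention n) (i : Fin k) (j : Fin n) (y : Bool) :
    CondBern (M.round a fun _ => none) (fun r => r.state = i) (fun r => r.x j = y)
      (valProb (M.q i j) y) := by
  intro u v huv
  rw [M.mean_round_eq _ _ (fun _ l x => if l = i then if x j = y then u else v else 1)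
    fun _ _ _ _ => rfl]
  have := mean_ite_le_one (valProb_nonneg _ _) (varLaw_none_prob (M.q i) j y) huv
  rw [← mean_const (varLaw M.q₀ a) 1]
  refine mean_mono fun x₀ _ => ?_
  rw [← mean_const (M.trans x₀) 1]
  refine mean_mono fun l _ => ?_
  by_cases h : l = i
  · subst h; simpa using this
  · simp [h, mean_const]

theorem meanReward_nonneg (i : Fin k) (b : Intervention n) : 0 ≤ M.meanReward i b :=
  Finset.sum_nonneg fun _ _ => mul_nonneg ENNReal.toReal_nonneg (M.rew _ _).2.1

theorem meanReward_le_one (i : Fin k) (b : Intervention n) : M.meanReward i b ≤ 1 := by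
  have h : ∑ y, varLaw (M.q i) b y = 1 := 
    (tsum_fintype (fun y => varLaw (M.q i) b y)).symm.trans (PMF.tsum_coe _)
  have h2 : ∑ y, (varLaw (M.q i) b y).toReal = 1 := by
    rw [← ENNReal.toReal_sum fun i _ => PMF.apply_ne_top _ _, h, ENNReal.toReal_one]
  rw [← h2]
  exact Finset.sum_le_sum fun y _ => mul_le_of_le_one_right ENNReal.toReal_nonneg (M.rew _ _).2.2

theorem mean_reward_le {i : Fin k} {b : Intervention n} {u v : ℝ≥0∞}
    (huv : ENNReal.ofReal (M.meanReward i b) * u + ENNReal.ofReal (1 - M.meanReward i b) * v ≤ 1) :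
    mean (varLaw (M.q i) b) (fun x => mean (bern (M.rew i x)) fun r => if r = true then u else v)
      ≤ 1 := by
  rw [← mean_bind]
  refine mean_ite_le_one (M.meanReward_nonneg i b) ?_ huv
  have : {r | r = true} = {true} := rfl
  rw [this, PMF.toOuterMeasure_apply_singleton, PMF.bind_apply, tsum_fintype, meanReward,
    ENNReal.ofReal_sum_of_nonneg fun _ _ => mul_nonneg ENNReal.toReal_nonneg (M.rew _ _).2.1]
  refine Finset.sum_congr rfl fun y _ => ?_
  rw [bern_true, ENNReal.ofReal_mul ENNReal.toReal_nonneg,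
    ENNReal.ofReal_toReal (PMF.apply_ne_top _ _)]

theorem condBern_reward (a : Intervention n) (i : Fin k) (b : Intervention n)
    (β : Fin k → Intervention n) :
    CondBern (M.round a β) (fun r => r.state = i ∧ r.act = b) (fun r => r.reward = true)
      (M.meanReward i b) := by
  intro u v huv
  rw [mean_round]
  have := M.mean_reward_le huv
  rw [← mean_const (varLaw M.q₀ a) 1]
  refine mean_mono fun x₀ _ => ?_
  rw [← mean_const (M.trans x₀) 1]
  refine mean_mono fun l _ => ?_
  by_cases h : l = i
  · subst h
    by_cases hb : β l = b
    · subst hb; simpa using this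
    · simp [hb, mean_const]
  · simp [h, mean_const]

theorem condBern_reward_of_agrees (a : Intervention n) (i : Fin k) (b : Intervention n) :
    CondBern (M.round a fun _ => none) (fun r => r.state = i ∧ Agrees b r.x)
      (fun r => r.reward = true) (M.meanReward i b) := by
  intro u v huv
  rw [mean_round]
  have := mean_varLaw_none_agrees (M.q i) b _ (M.mean_reward_le huv)
  rw [← mean_const (varLaw M.q₀ a) 1]
  refine mean_mono fun x₀ _ => ?_
  rw [← mean_const (M.trans x₀) 1]
  refine mean_mono fun l _ => ?_
  by_cases h : l = i
  · subst h
    refine le_of_eq_of_le ?_ this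
    congr 1; ext x
    by_cases h : Agrees b x <;> simp [h, mean_const]
  · simp [h, mean_const]

end Model

/-! ### Concentration along a run -/

/-- The factor of the exponential supermartingale that compares the number of occurrences of `e`
with its compensator `p` times the number of occurrences of `c`. -/
def tilt {α : Type*} (c e : α → Prop) [DecidablePred c] [DecidablePred e] (s p : ℝ) (r : α) :
    ℝ≥0∞ :=
  if c r then
    if e r then ENNReal.ofReal (Real.exp (s - p * (Real.exp s - 1)))
    else ENNReal.ofReal (Real.exp (-(p * (Real.exp s - 1))))
  else 1

/-- With `κ = p (exp s - 1)` the weighted average of the two factors is `(1 + κ) exp (-κ) ≤ 1`. -/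
theorem CondBern.mean_tilt_le {α : Type*} {ρ : PMF α} {c e : α → Prop} [DecidablePred c]
    [DecidablePred e] {p : ℝ} (h : CondBern ρ c e p) (hp0 : 0 ≤ p) (hp1 : p ≤ 1) (s : ℝ) :
    mean ρ (tilt c e s p) ≤ 1 := by
  refine h _ _ ?_
  rw [← ENNReal.ofReal_mul hp0, ← ENNReal.ofReal_mul (sub_nonneg.2 hp1),
    ← ENNReal.ofReal_add (by positivity) (mul_nonneg (sub_nonneg.2 hp1) (Real.exp_pos _).le)]
  rw [ENNReal.ofReal_le_one, sub_eq_add_neg, Real.exp_add]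
  set κ := p * (Real.exp s - 1) with hκ
  have h1 : p * (Real.exp s * Real.exp (-κ)) + (1 - p) * Real.exp (-κ) =
      (κ + 1) * Real.exp (-κ) := by rw [hκ]; ring
  rw [h1]
  calc (κ + 1) * Real.exp (-κ) ≤ Real.exp κ * Real.exp (-κ) :=
        mul_le_mul_of_nonneg_right (Real.add_one_le_exp κ) (Real.exp_pos _).le
    _ = 1 := by rw [← Real.exp_add]; simp

theorem prod_map_tilt {α : Type*} (c e : α → Prop) [DecidablePred c] [DecidablePred e]
    (s p : ℝ) (h : List α) :
    (h.map (tilt c e s p)).prod = ENNReal.ofReal (Real.exp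
      (s * (h.countP fun r => c r ∧ e r : ℕ) - p * (Real.exp s - 1) * (h.countP fun r => c r : ℕ)))
      := by
  induction h with
  | nil => simp
  | cons r h ih =>
    rw [List.map_cons, List.prod_cons, ih, tilt]
    by_cases hc : c r
    · by_cases he : e r
      · simp only [hc, he, if_true, List.countP_cons, and_self, decide_true]
        rw [← ENNReal.ofReal_mul (Real.exp_pos _).le, ← Real.exp_add]
        congr 2; push_cast; ring
      · simp only [hc, he, if_true, if_false, List.countP_cons, and_false, decide_true,
          decide_false, Bool.false_eq_true]
        rw [← ENNReal.ofReal_mul (Real.exp_pos _).le, ← Real.exp_add]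
        congr 2; push_cast; ring
    · simp [hc]

/-- The deviations of the number `s` of successes among `n` trials from its mean `n * p` are of the
order that corresponds to a failure probability `exp (-L)`. -/
def Conc (L p : ℝ) (n s : ℕ) : Prop :=
  (L ≤ n * p → |(s : ℝ) - n * p| ≤ 2 * √(n * p * L)) ∧
  (L ≤ n → |(s : ℝ) - n * p| ≤ 2 * √(n * L)) ∧
  (s : ℝ) ≤ 2 * (n * p) + L

theorem le_two_sqrt {x L D s : ℝ} (hL : 0 < L) (hx : L ≤ x) (hs : s = √(L / x))
    (h : s * D ≤ 2 * L) : D ≤ 2 * √(x * L) := by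
  have hx0 : 0 < x := hL.trans_le hx
  have hs0 : 0 < s := by rw [hs]; exact Real.sqrt_pos.2 (div_pos hL hx0)
  refine le_of_mul_le_mul_left (h.trans_eq ?_) hs0
  have : s * √(x * L) = L := by
    rw [hs, ← Real.sqrt_mul (div_pos hL hx0).le]
    rw [show L / x * (x * L) = L ^ 2 by field_simp]
    exact Real.sqrt_sq hL.le
  linear_combination -2 * this

/-- The finitely many exponents for which the deviations of the supermartingale are controlled. -/
def exponents (L p : ℝ) (l : ℕ) : Finset ℝ :=
  (insert 1 ((Finset.range (l + 1)).biUnion fun n =>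
    {√(L / (n * p)), -√(L / (n * p)), √(L / n), -√(L / n)})).filter fun s => |s| ≤ 1

theorem card_exponents_le (L p : ℝ) (l : ℕ) : (exponents L p l).card ≤ 5 * (l + 1) := by
  have h : ((Finset.range (l + 1)).biUnion fun n : ℕ =>
      ({√(L / (n * p)), -√(L / (n * p)), √(L / n), -√(L / n)} : Finset ℝ)).card ≤
      (Finset.range (l + 1)).card * 4 :=
    Finset.card_biUnion_le_card_mul _ _ _ fun n _ => Finset.card_le_four
  rw [Finset.card_range] at h
  refine (Finset.card_filter_le _ _).trans ((Finset.card_insert_le _ _).trans ?_)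
  omega

/-- The exponents `±√(L/(np))`, `±√(L/n)` and `1` yield the three clauses; `L ≤ np` and `L ≤ n` keep
the first four in `[-1, 1]`. The clauses serve, in turn, estimates relative to `p`, reward means
with no lower bound on `p`, and rare values of arbitrarily small probability. -/
theorem conc_of_exponents {L p : ℝ} {l n s : ℕ} (hL : 0 < L) (hp1 : p ≤ 1)
    (hn : n ≤ l) (h : ∀ t ∈ exponents L p l, t * (s - n * p) ≤ n * p * t ^ 2 + L) :
    Conc L p n s := by
  have key : ∀ x : ℝ, L ≤ x → n * p ≤ x →
      (∀ t ∈ ({√(L / x), -√(L / x)} : Finset ℝ), |t| ≤ 1 → t * (s - n * p) ≤ n * p * t ^ 2 + L) →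
      |(s : ℝ) - n * p| ≤ 2 * √(x * L) := by
    intro x hx hnx hk
    have hx0 : 0 < x := hL.trans_le hx
    have hsq : √(L / x) ^ 2 = L / x := Real.sq_sqrt (div_pos hL hx0).le
    have habs : |√(L / x)| ≤ 1 := by
      rw [abs_of_nonneg (Real.sqrt_nonneg _)]
      exact Real.sqrt_le_one.2 ((div_le_one hx0).2 hx)
    have hb : n * p * (L / x) ≤ L := by
      rw [mul_div_assoc', div_le_iff₀ hx0]
      nlinarith
    have h1 := hk _ (by simp) habs
    have h2 := hk (-√(L / x)) (by simp) (by rwa [abs_neg])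
    rw [neg_sq, hsq] at h2
    rw [hsq] at h1
    refine abs_le'.2 ⟨le_two_sqrt hL hx rfl (by linarith), le_two_sqrt hL hx rfl ?_⟩
    linarith
  have hmem : n ∈ Finset.range (l + 1) := Finset.mem_range.2 (by omega)
  refine ⟨fun hx => key _ hx le_rfl fun t ht ht1 => h t ?_,
    fun hx => key _ hx (mul_le_of_le_one_right (Nat.cast_nonneg n) hp1) fun t ht ht1 => h t ?_, ?_⟩
  · refine Finset.mem_filter.2 ⟨Finset.mem_insert_of_mem (Finset.mem_biUnion.2 ⟨n, hmem, ?_⟩), ht1⟩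
    simp only [Finset.mem_insert, Finset.mem_singleton] at ht ⊢
    tauto
  · refine Finset.mem_filter.2 ⟨Finset.mem_insert_of_mem (Finset.mem_biUnion.2 ⟨n, hmem, ?_⟩), ht1⟩
    simp only [Finset.mem_insert, Finset.mem_singleton] at ht ⊢
    tauto
  · have := h 1 (Finset.mem_filter.2 ⟨Finset.mem_insert_self _ _, by simp⟩)
    linarith

/-- The bound for the probability that `Conc` fails in a run of `l` rounds. -/
def failProb (L : ℝ) (l : ℕ) : ℝ≥0∞ := (5 * (l + 1) : ℕ) * ENNReal.ofReal (Real.exp (-L))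

namespace Model

variable {n k : ℕ} (M : Model n k)

/-- The supermartingale property, by induction on the schedule. Since the one-round bound holds
after every history, the rule may be adaptive. -/
theorem mean_play_prod_le (rule : List (Round n k) → Fin k → Intervention n)
    (w : Round n k → ℝ≥0∞) (acts : List (Intervention n)) (h₀ : List (Round n k))
    (hw : ∀ a ∈ acts, ∀ h, mean (M.round a (rule h)) w ≤ 1) :
    mean (M.play rule acts h₀) (fun h => (h.map w).prod) ≤ (h₀.map w).prod := by
  induction acts generalizing h₀ with
  | nil => simp [Model.play, mean_pure]
  | cons a as ih =>
    rw [Model.play, mean_bind]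
    calc _ ≤ mean (M.round a (rule h₀)) (fun r => (h₀.map w).prod * w r) := by
          refine mean_mono fun r _ => (ih (r :: h₀) fun b hb => hw b (List.mem_cons_of_mem _ hb)).trans ?_
          rw [List.map_cons, List.prod_cons, mul_comm]
      _ ≤ (h₀.map w).prod * 1 := by
          rw [mean_const_mul]
          gcongr
          exact hw a List.mem_cons_self h₀
      _ = _ := mul_one _

theorem map_act₀_of_mem_play {rule : List (Round n k) → Fin k → Intervention n}
    {acts : List (Intervention n)} {h₀ h : List (Round n k)}
    (hh : h ∈ (M.play rule acts h₀).support) :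
    h.map Round.act₀ = acts.reverse ++ h₀.map Round.act₀ := by
  induction acts generalizing h₀ with
  | nil =>
    simp only [Model.play, PMF.support_pure, Set.mem_singleton_iff] at hh
    simp [hh]
  | cons a as ih =>
    rw [Model.play, PMF.mem_support_bind_iff] at hh
    obtain ⟨r, hr, hh⟩ := hh
    rw [ih hh, List.map_cons, (M.mem_support_round hr).1]
    simp

/-- Together with `CondBern.ne_zero` this shows that events of conditional probability zero never
occur in a run, so zero transition probabilities are estimated as exactly zero. -/
theorem exists_round_of_mem_play {rule : List (Round n k) → Fin k → Intervention n}
    {acts : List (Intervention n)} {h₀ h : List (Round n k)}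
    (hh : h ∈ (M.play rule acts h₀).support) {r : Round n k} (hr : r ∈ h) :
    r ∈ h₀ ∨ ∃ a ∈ acts, ∃ g, r ∈ (M.round a (rule g)).support := by
  induction acts generalizing h₀ with
  | nil =>
    simp only [Model.play, PMF.support_pure, Set.mem_singleton_iff] at hh
    exact Or.inl (hh ▸ hr)
  | cons a as ih =>
    rw [Model.play, PMF.mem_support_bind_iff] at hh
    obtain ⟨r', hr', hh⟩ := hh
    rcases ih hh with h1 | ⟨b, hb, g, hg⟩
    · rcases List.mem_cons.1 h1 with rfl | h1
      · exact Or.inr ⟨a, List.mem_cons_self, h₀, hr'⟩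
      · exact Or.inl h1
    · exact Or.inr ⟨b, List.mem_cons_of_mem _ hb, g, hg⟩

theorem countP_act₀_of_mem_play {rule : List (Round n k) → Fin k → Intervention n}
    {acts : List (Intervention n)} {h : List (Round n k)}
    (hh : h ∈ (M.play rule acts []).support) (a : Intervention n) :
    h.countP (fun r => r.act₀ = a) = acts.count a := by
  have h1 := congrArg (List.count a) (M.map_act₀_of_mem_play hh)
  rw [List.map_nil, List.append_nil, List.count_reverse] at h1
  rw [← h1, List.count, List.countP_map]
  refine List.countP_congr fun r _ => ?_
  simp

theorem length_of_mem_play {rule : List (Round n k) → Fin k → Intervention n}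
    {acts : List (Intervention n)} {h : List (Round n k)}
    (hh : h ∈ (M.play rule acts []).support) : h.length = acts.length := by
  simpa using congrArg List.length (M.map_act₀_of_mem_play hh)

/-- Markov's inequality for the product of the factors `tilt`, simplified by `exp s - 1 ≤ s + s ^ 2`
for `|s| ≤ 1`. -/
theorem play_deviation (rule : List (Round n k) → Fin k → Intervention n)
    (acts : List (Intervention n)) {c e : Round n k → Prop} [DecidablePred c] [DecidablePred e]
    {p : ℝ} (hp0 : 0 ≤ p) (hp1 : p ≤ 1)
    (hb : ∀ a ∈ acts, ∀ h, CondBern (M.round a (rule h)) c e p) (L : ℝ) {s : ℝ} (hs : |s| ≤ 1) :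
    (M.play rule acts []).toOuterMeasure {h | ¬ s * ((h.countP fun r => c r ∧ e r : ℕ) -
      (h.countP fun r => c r : ℕ) * p) ≤ (h.countP fun r => c r : ℕ) * p * s ^ 2 + L} ≤
      ENNReal.ofReal (Real.exp (-L)) := by
  have h1 := M.mean_play_prod_le rule (tilt c e s p) acts []
    fun a ha h => (hb a ha h).mean_tilt_le hp0 hp1 s
  rw [toOuterMeasure_eq_mean]
  calc _ ≤ mean (M.play rule acts []) (fun h => ENNReal.ofReal (Real.exp (-L)) *
        (h.map (tilt c e s p)).prod) := by
        refine mean_mono fun h _ => ?_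
        refine Set.indicator_apply_le' (fun hh => ?_) fun _ => zero_le
        rw [prod_map_tilt, ← ENNReal.ofReal_mul (Real.exp_pos _).le, ← Real.exp_add, Pi.one_apply,
          ENNReal.one_le_ofReal, Real.one_le_exp_iff]
        rw [Set.mem_ofPred_eq, not_le] at hh
        have h2 := (abs_le.1 (Real.abs_exp_sub_one_sub_id_le hs)).2
        have h3 : (0 : ℝ) ≤ p * (h.countP fun r => c r : ℕ) := by positivity
        nlinarith
    _ ≤ ENNReal.ofReal (Real.exp (-L)) * 1 := by
        rw [mean_const_mul]
        gcongr
        simpa using h1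
    _ = _ := mul_one _

/-- The right exponent depends on the count of `c`, which is random. It takes at most `acts.length +
1` values, so all the corresponding exponents are treated at once by a union bound. -/
theorem play_conc (rule : List (Round n k) → Fin k → Intervention n)
    (acts : List (Intervention n)) {c e : Round n k → Prop} [DecidablePred c] [DecidablePred e]
    {p : ℝ} (hp0 : 0 ≤ p) (hp1 : p ≤ 1)
    (hb : ∀ a ∈ acts, ∀ h, CondBern (M.round a (rule h)) c e p) {L : ℝ} (hL : 0 < L) :
    (M.play rule acts []).toOuterMeasure {h | ¬ Conc L p (h.countP fun r => c r)
      (h.countP fun r => c r ∧ e r)} ≤ failProb L acts.length := by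
  -- Inclusion is needed only on the support, where the length of the history is known and bounds
  -- the count.
  refine (PMF.toOuterMeasure_mono _ (t := ⋃ s ∈ exponents L p acts.length,
    {h | ¬ s * ((h.countP fun r => c r ∧ e r : ℕ) -
      (h.countP fun r => c r : ℕ) * p) ≤ (h.countP fun r => c r : ℕ) * p * s ^ 2 + L}) ?_).trans ?_
  · rintro h ⟨hc, hsupp⟩
    by_contra hcon
    simp only [Set.mem_iUnion, Set.mem_ofPred_eq, not_exists, not_not] at hcon
    refine hc (conc_of_exponents hL hp1 ?_ hcon)
    rw [← M.length_of_mem_play hsupp]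
    exact List.countP_le_length
  · refine (MeasureTheory.measure_biUnion_finset_le _ _).trans ?_
    refine (Finset.sum_le_card_nsmul _ _ (ENNReal.ofReal (Real.exp (-L))) fun s hs =>
      M.play_deviation rule acts hp0 hp1 hb L (Finset.mem_filter.1 hs).2).trans ?_
    rw [nsmul_eq_mul, failProb]
    gcongr
    exact card_exponents_le _ _ _

/-- Finitely many instances of `Conc` hold simultaneously. -/
theorem play_forall_conc {ι : Type*} (rule : List (Round n k) → Fin k → Intervention n)
    (acts : List (Intervention n)) (I : Finset ι) (c e : ι → Round n k → Prop)
    [∀ x, DecidablePred (c x)] [∀ x, DecidablePred (e x)]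
    {p : ι → ℝ} (hp0 : ∀ x, 0 ≤ p x) (hp1 : ∀ x, p x ≤ 1)
    (hb : ∀ x, ∀ a ∈ acts, ∀ h, CondBern (M.round a (rule h)) (c x) (e x) (p x)) {L : ℝ}
    (hL : 0 < L) :
    (M.play rule acts []).toOuterMeasure {h | ¬ ∀ x ∈ I, Conc L (p x) (h.countP fun r => c x r)
      (h.countP fun r => c x r ∧ e x r)} ≤ I.card * failProb L acts.length := by
  refine (MeasureTheory.measure_mono (t := ⋃ x ∈ I, {h | ¬ Conc L (p x) (h.countP fun r => c x r)
      (h.countP fun r => c x r ∧ e x r)}) ?_).trans ?_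
  · intro h hh
    simpa using hh
  · refine (MeasureTheory.measure_biUnion_finset_le _ _).trans ?_
    refine (Finset.sum_le_card_nsmul _ _ _ fun x _ =>
      M.play_conc rule acts (hp0 x) (hp1 x) (hb x) hL).trans ?_
    rw [nsmul_eq_mul]

end Model

/-! ### The causal parameter -/

theorem minProb_order_mono {n : ℕ} (q : Fin n → ℝ) : Monotone fun j => minProb q (order q j) :=
  Tuple.monotone_sort (minProb q)

theorem causalParam_le {n : ℕ} (q : Fin n → ℝ) : causalParam q ≤ n :=
  Finset.sup_le fun j _ => j.2

/-- The sorted probabilities increase while the thresholds `1/(j + 1)` decrease, so the positions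
below their threshold form an initial segment. -/
theorem minProb_order_lt_iff {n : ℕ} (q : Fin n → ℝ) (j : Fin n) :
    minProb q (order q j) < 1 / ((j : ℝ) + 1) ↔ (j : ℕ) < causalParam q := by
  constructor
  · intro h
    exact Nat.lt_of_succ_le (Finset.le_sup (f := fun j : Fin n => (j : ℕ) + 1)
      (Finset.mem_filter.2 ⟨Finset.mem_univ _, h⟩))
  · intro h
    have hne : (Finset.univ.filter fun j : Fin n =>
        minProb q (order q j) < 1 / ((j : ℝ) + 1)).Nonempty := by
      by_contra hcon
      rw [Finset.not_nonempty_iff_eq_empty] at hcon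
      rw [causalParam, hcon] at h
      simp at h
    obtain ⟨l, hl, hl'⟩ := Finset.exists_mem_eq_sup _ hne fun j : Fin n => (j : ℕ) + 1
    have hjl : j ≤ l := by
      rw [causalParam, hl'] at h
      exact Fin.le_def.2 (by omega)
    refine (minProb_order_mono q hjl).trans_lt ((Finset.mem_filter.1 hl).2.trans_le ?_)
    have : (j : ℝ) ≤ l := by exact_mod_cast hjl
    gcongr

/-- With `le_card_of_le_causalParam` this characterizes the causal parameter without sorting, for `J
≥ 1`: it is at least `J` exactly when at least `J` variables have `minProb` below `1/J`. Two
parameter vectors can then be compared although they sort the variables differently. -/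
theorem le_causalParam {n : ℕ} {q : Fin n → ℝ} {J : ℕ} (hJ : 1 ≤ J)
    (h : J ≤ (Finset.univ.filter fun j => minProb q j < 1 / (J : ℝ)).card) :
    J ≤ causalParam q := by
  have hn : J ≤ n := h.trans ((Finset.card_le_univ _).trans_eq (Fintype.card_fin n))
  have hlt : minProb q (order q ⟨J - 1, by omega⟩) < 1 / (((J - 1 : ℕ) : ℝ) + 1) := by
    by_contra! hcon
    rw [show ((J - 1 : ℕ) : ℝ) + 1 = J by rw [Nat.cast_sub hJ]; push_cast; ring] at hcon
    have hsub : (Finset.univ.filter fun j => minProb q j < 1 / (J : ℝ)) ⊆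
        (Finset.univ.filter fun j : Fin n => (j : ℕ) < J - 1).image (order q) := by
      intro j hj
      refine Finset.mem_image.2 ⟨(order q).symm j, ?_, by simp⟩
      refine Finset.mem_filter.2 ⟨Finset.mem_univ _, ?_⟩
      by_contra! hge
      have := minProb_order_mono q (show (⟨J - 1, by omega⟩ : Fin n) ≤ (order q).symm j from hge)
      simp only [Equiv.apply_symm_apply] at this
      exact absurd (Finset.mem_filter.1 hj).2 (not_lt.2 (hcon.trans this))
    have := h.trans ((Finset.card_le_card hsub).trans Finset.card_image_le)
    rw [Fin.card_filter_val_lt] at this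
    omega
  have := (minProb_order_lt_iff q _).1 hlt
  simp only at this
  omega

theorem le_card_of_le_causalParam {n : ℕ} {q : Fin n → ℝ} {J : ℕ} (hJ : 1 ≤ J)
    (h : J ≤ causalParam q) :
    J ≤ (Finset.univ.filter fun j => minProb q j < 1 / (J : ℝ)).card := by
  have hn : J ≤ n := h.trans (causalParam_le q)
  have hlt := (minProb_order_lt_iff q ⟨J - 1, by omega⟩).2 (by simp only; omega)
  simp only at hlt
  rw [show ((J - 1 : ℕ) : ℝ) + 1 = J by rw [Nat.cast_sub hJ]; push_cast; ring] at hlt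
  calc J = (Finset.univ.filter fun j : Fin n => (j : ℕ) < J).card := by
        rw [Fin.card_filter_val_lt]; omega
    _ = ((Finset.univ.filter fun j : Fin n => (j : ℕ) < J).image (order q)).card :=
        (Finset.card_image_of_injective _ (order q).injective).symm
    _ ≤ _ := by
        refine Finset.card_le_card fun j hj => ?_
        obtain ⟨l, hl, rfl⟩ := Finset.mem_image.1 hj
        have hl' := (Finset.mem_filter.1 hl).2
        exact Finset.mem_filter.2 ⟨Finset.mem_univ _, (minProb_order_mono q
          (show l ≤ ⟨J - 1, by omega⟩ from Fin.le_def.2 (by simp only; omega))).trans_lt hlt⟩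

theorem one_le_causalParam {n : ℕ} (hn : 1 ≤ n) (q : Fin n → ℝ) : 1 ≤ causalParam q := by
  refine Nat.one_le_iff_ne_zero.2 (Nat.pos_iff_ne_zero.1 ((minProb_order_lt_iff q ⟨0, hn⟩).1 ?_))
  simp only [minProb, Nat.cast_zero, zero_add, div_one]
  rcases le_total (q (order q ⟨0, hn⟩)) (1 / 2) with h | h
  · exact (min_le_left _ _).trans_lt (by linarith)
  · exact (min_le_right _ _).trans_lt (by linarith)

theorem minProb_eq_valProb {n : ℕ} (q : Fin n → ℝ) (j : Fin n) :
    minProb q j = valProb (q j) (rareVal q j) := by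
  by_cases h : q j ≤ 1 - q j
  · simp [minProb, rareVal, valProb, h]
  · simp [minProb, rareVal, valProb, h, (not_le.1 h).le]

theorem minProb_le_valProb {n : ℕ} (q : Fin n → ℝ) (j : Fin n) (x : Bool) :
    minProb q j ≤ valProb (q j) x := by
  cases x <;> simp [minProb, valProb]

/-- Interventions outside of `rareInterventions` agree with sufficiently many observations. -/
theorem le_valProb_of_notMem {n : ℕ} {q : Fin n → ℝ} {j : Fin n} {x : Bool}
    (h : some (j, x) ∉ rareInterventions q) :
    1 / ((causalParam q : ℝ) + 1) ≤ valProb (q j) x := by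
  have hn : 1 ≤ n := j.pos
  have hm : (1 : ℝ) ≤ causalParam q := by exact_mod_cast one_le_causalParam hn q
  by_cases hx : x = rareVal q j
  · rw [hx, ← minProb_eq_valProb]
    by_contra! hlt
    -- A rare value left out belongs to a variable at position `m` or later (counting from 0), where
    -- `minProb` is at least `1/(m + 1)`.
    have hge : causalParam q ≤ (order q).symm j := by
      by_contra! hcon
      refine h (List.mem_map.2 ⟨(order q).symm j, ?_, by simp [hx]⟩)
      rw [List.mem_take_iff_getElem]
      exact ⟨(order q).symm j, by simp [hcon], by simp⟩
    have hmn : causalParam q < n := hge.trans_lt (Fin.is_lt _)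
    have h1 := minProb_order_mono q (show (⟨causalParam q, hmn⟩ : Fin n) ≤ (order q).symm j from hge)
    simp only [Equiv.apply_symm_apply] at h1
    exact lt_irrefl _ ((minProb_order_lt_iff q ⟨causalParam q, hmn⟩).1 (h1.trans_lt hlt))
  -- The likelier value has probability at least `1/2`, which suffices because `m ≥ 1`.
  · have h1 : (1 : ℝ) / 2 ≤ valProb (q j) x := by
      by_cases hq : q j ≤ 1 - q j
      · have hx' : x = false := by simpa [rareVal, hq] using hx
        simp only [hx', valProb, Bool.false_eq_true, if_false]; linarith
      · have hx' : x = true := by simpa [rareVal, hq] using hx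
        simp only [hx', valProb, if_true]; linarith
    refine le_trans ?_ h1
    gcongr
    linarith

theorem length_rareInterventions {n : ℕ} (q : Fin n → ℝ) :
    (rareInterventions q).length = causalParam q := by
  simp [rareInterventions, causalParam_le]

theorem nodup_rareInterventions {n : ℕ} (q : Fin n → ℝ) : (rareInterventions q).Nodup := by
  refine List.Nodup.map ?_ ((List.nodup_finRange n).sublist (List.take_sublist _ _))
  intro a b hab
  simpa using congrArg (Option.map Prod.fst) hab

/-- If `m' > 3m`, then `m' ≥ 2(m + 1)` as `m ≥ 1`; so `2(m + 1)` variables have `minProb q'` below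
`1/(2(m + 1))`, hence `minProb q` below `1/(m + 1)`, which would force `m ≥ m + 1`. -/
theorem causalParam_le_of_minProb {n : ℕ} (hn : 1 ≤ n) {q q' : Fin n → ℝ}
    (h : ∀ j, 1 / ((causalParam q : ℝ) + 1) ≤ minProb q j →
      1 / (2 * ((causalParam q : ℝ) + 1)) ≤ minProb q' j) :
    causalParam q' ≤ 3 * causalParam q := by
  by_contra! hcon
  have hm := one_le_causalParam hn q
  have h1 := le_card_of_le_causalParam (q := q') (J := 2 * (causalParam q + 1)) (by omega) (by omega)
  have h2 : causalParam q + 1 ≤ causalParam q := by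
    refine le_causalParam (by omega) (le_trans (by omega) (h1.trans (Finset.card_le_card ?_)))
    intro j hj
    refine Finset.mem_filter.2 ⟨Finset.mem_univ _, ?_⟩
    by_contra! hge
    push_cast at hge
    have := h j hge
    have hj' := (Finset.mem_filter.1 hj).2
    push_cast at hj'
    exact absurd hj' (not_lt.2 this)
  omega

/-- The `m` variables below `1/m` for `q` are below `3/m ≤ 1/⌊m/3⌋` for `q'`, so `m' ≥ ⌊m/3⌋`. For
`m ≤ 5` the bound `m' ≥ 1` is enough. -/
theorem causalParam_ge_of_minProb {n : ℕ} (hn : 1 ≤ n) {q q' : Fin n → ℝ}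
    (h : ∀ j, minProb q j < 1 / (causalParam q : ℝ) → minProb q' j < 3 / (causalParam q : ℝ)) :
    causalParam q ≤ 5 * causalParam q' := by
  have hm := one_le_causalParam hn q
  have hm' := one_le_causalParam hn q'
  by_cases h5 : causalParam q ≤ 5
  · omega
  have h1 := le_card_of_le_causalParam hm le_rfl
  have h2 : causalParam q / 3 ≤ causalParam q' := by
    refine le_causalParam (by omega) (le_trans (by omega) (h1.trans (Finset.card_le_card ?_)))
    intro j hj
    refine Finset.mem_filter.2 ⟨Finset.mem_univ _, (h j (Finset.mem_filter.1 hj).2).trans_le ?_⟩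
    have h3 : (0 : ℝ) < (causalParam q / 3 : ℕ) := by
      exact_mod_cast Nat.div_pos (by omega) (by norm_num)
    have h4 : ((causalParam q / 3 : ℕ) : ℝ) * 3 ≤ causalParam q := by
      exact_mod_cast Nat.div_mul_le_self _ _
    rw [div_le_div_iff₀ (by linarith) h3]
    linarith
  omega

/-! ### Empirical frequencies -/

theorem freq_nonneg {α : Type} (h : List α) (c e : α → Prop) [DecidablePred c] [DecidablePred e] :
    0 ≤ freq h c e := by unfold freq; positivity

theorem countP_and_le {α : Type*} (h : List α) (c e : α → Prop) [DecidablePred c]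
    [DecidablePred e] : (h.countP fun r => c r ∧ e r) ≤ h.countP fun r => c r :=
  List.countP_mono_left fun r _ hr => by simp_all

theorem freq_le_one {α : Type} (h : List α) (c e : α → Prop) [DecidablePred c] [DecidablePred e] :
    freq h c e ≤ 1 := by
  refine div_le_one_of_le₀ ?_ (Nat.cast_nonneg _)
  exact_mod_cast countP_and_le h c e

/-- The count must be positive: an empty sample has frequency 0 for both values, whereas `valProb`
would give 1 to `false`. -/
theorem freq_not {α : Type} (h : List α) (c : α → Prop) [DecidablePred c] (X : α → Bool)
    (hc : 0 < h.countP fun r => c r) (y : Bool) :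
    valProb (freq h c fun r => X r = true) y = freq h c fun r => X r = y := by
  cases y
  · have h1 : (h.countP fun r => c r ∧ X r = true) + (h.countP fun r => c r ∧ X r = false) =
        h.countP fun r => c r := by
      clear hc
      induction h with
      | nil => rfl
      | cons r h ih =>
        simp only [List.countP_cons, ← ih]
        by_cases hr : c r <;> cases hx : X r <;> simp [hr] <;> omega
    have h2 : ((h.countP fun r => c r : ℕ) : ℝ) ≠ 0 := by exact_mod_cast hc.ne'
    simp only [valProb, freq, Bool.false_eq_true, if_false]
    rw [eq_div_iff h2, sub_mul, div_mul_cancel₀ _ h2, ← h1]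
    push_cast; ring
  · simp [valProb]

theorem sqrt_mul_eq {m x : ℝ} (hm : 0 < m) (hx : 0 ≤ x) : √(m * x) = √(x / m) * m := by
  rw [show m * x = x / m * m ^ 2 by field_simp, Real.sqrt_mul (by positivity), Real.sqrt_sq hm.le]

theorem Conc.freq_close {α : Type} {h : List α} {c e : α → Prop} [DecidablePred c]
    [DecidablePred e] {L p : ℝ}
    (hc : Conc L p (h.countP fun r => c r) (h.countP fun r => c r ∧ e r))
    (hL : 0 < L) {N : ℝ} (hN : N ≤ (h.countP fun r => c r : ℕ)) (hp : 0 ≤ p) (hLN : L ≤ N * p) :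
    |freq h c e - p| ≤ 2 * √(p * L / N) := by
  set m := h.countP fun r => c r with hm
  set s := h.countP fun r => c r ∧ e r with hs
  have hN0 : 0 < N := by
    by_contra! hcon
    nlinarith
  have hm0 : (0 : ℝ) < m := hN0.trans_le hN
  have h1 := hc.1 (hLN.trans (by gcongr))
  have h2 : freq h c e - p = (s - m * p) / m := by
    rw [freq, ← hm, ← hs]; field_simp
  rw [h2, abs_div, abs_of_pos hm0, div_le_iff₀ hm0]
  refine h1.trans ?_
  have h3 : √(m * p * L) = √(p * L / m) * m := by
    rw [mul_assoc, sqrt_mul_eq hm0 (by positivity)]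
  rw [h3, ← mul_assoc]
  gcongr

theorem Conc.freq_close' {α : Type} {h : List α} {c e : α → Prop} [DecidablePred c]
    [DecidablePred e] {L p : ℝ}
    (hc : Conc L p (h.countP fun r => c r) (h.countP fun r => c r ∧ e r))
    (hL : 0 < L) {N : ℝ} (hN : N ≤ (h.countP fun r => c r : ℕ)) (hLN : L ≤ N) :
    |freq h c e - p| ≤ 2 * √(L / N) := by
  set m := h.countP fun r => c r with hm
  set s := h.countP fun r => c r ∧ e r with hs
  have hN0 : 0 < N := hL.trans_le hLN
  have hm0 : (0 : ℝ) < m := hN0.trans_le hN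
  have h1 := hc.2.1 (hLN.trans hN)
  have h2 : freq h c e - p = (s - m * p) / m := by
    rw [freq, ← hm, ← hs]; field_simp
  rw [h2, abs_div, abs_of_pos hm0, div_le_iff₀ hm0]
  refine h1.trans ?_
  have h3 : √(m * L) = √(L / m) * m := sqrt_mul_eq hm0 hL.le
  rw [h3, ← mul_assoc]
  gcongr

theorem Conc.half_le {L p : ℝ} {m s : ℕ} (hc : Conc L p m s) (hL : 0 < L)
    (h : 16 * L ≤ m * p) : m * p / 2 ≤ s := by
  have h1 := (abs_le.1 (hc.1 (by linarith))).1
  have h2 : √(m * p * L) ≤ m * p / 4 := by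
    rw [Real.sqrt_le_left (by linarith)]
    nlinarith
  linarith

theorem two_sqrt_le_half {p L N : ℝ} (hL : 0 < L) (hp : 0 < p) (h : 16 * L ≤ N * p) :
    2 * √(p * L / N) ≤ p / 2 := by
  have hN : 0 < N := by
    by_contra! hcon
    nlinarith
  have : √(p * L / N) ≤ p / 4 := by
    rw [Real.sqrt_le_left (by linarith), div_le_iff₀ hN]
    nlinarith
  linarith

/-- The causal parameter of empirical frequencies is within constant factors of the true one. -/
theorem causalParam_freq {α : Type} {n : ℕ} (hn : 1 ≤ n) {h : List α} {c : α → Prop}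
    [DecidablePred c] {X : α → Fin n → Bool} {q : Fin n → ℝ} {L : ℝ} (hL : 0 < L)
    (hconc : ∀ j y, Conc L (valProb (q j) y) (h.countP fun r => c r)
      (h.countP fun r => c r ∧ X r j = y))
    (hcount : 16 * L * ((causalParam q : ℝ) + 1) ≤ (h.countP fun r => c r : ℕ)) :
    causalParam (fun j => freq h c fun r => X r j = true) ≤ 3 * causalParam q ∧
      causalParam q ≤ 5 * causalParam (fun j => freq h c fun r => X r j = true) := by
  set q' : Fin n → ℝ := fun j => freq h c fun r => X r j = true with hq'
  have hm : (1 : ℝ) ≤ causalParam q := by exact_mod_cast one_le_causalParam hn q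
  set m : ℝ := (causalParam q : ℝ)
  set N : ℕ := h.countP fun r => c r with hN
  have hN0 : (0 : ℝ) < N := lt_of_lt_of_le (by positivity) hcount
  have hval : ∀ j y, valProb (q' j) y = (h.countP fun r => c r ∧ X r j = y : ℕ) / (N : ℝ) :=
    fun j y => freq_not h c (fun r => X r j) (by exact_mod_cast hN0) y
  constructor
  · refine causalParam_le_of_minProb hn fun j hj => ?_
    rw [minProb_eq_valProb q', hval, le_div_iff₀ hN0]
    -- The empirically rarer value: its true probability is still at least `1/(m + 1)`, and its
    -- frequency at least half of that.
    set y := rareVal q' j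
    have h1 : 1 / (m + 1) ≤ valProb (q j) y := hj.trans (minProb_le_valProb q j y)
    have h2 : 16 * L ≤ N * valProb (q j) y := by
      rw [div_le_iff₀ (by linarith)] at h1
      have h3 : 0 < valProb (q j) y := by
        by_contra! hcon
        nlinarith
      nlinarith
    refine le_trans ?_ ((hconc j y).half_le hL h2)
    rw [show N * valProb (q j) y / 2 = valProb (q j) y / 2 * N by ring]
    refine mul_le_mul_of_nonneg_right ?_ hN0.le
    rw [mul_comm, ← div_div]
    linarith
  · refine causalParam_ge_of_minProb hn fun j hj => ?_
    rw [minProb_eq_valProb q] at hj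
    refine (minProb_le_valProb q' j (rareVal q j)).trans_lt ?_
    rw [hval, div_lt_div_iff₀ hN0 (by linarith)]
    set y := rareVal q j
    -- The truly rarer value may have any small probability, so only the one-sided clause `s ≤ 2Np +
    -- L` applies. With `p < 1/m` and `L m ≤ N` it puts the frequency below `3/m`.
    have h1 := (hconc j y).2.2
    change valProb (q j) y < 1 / m at hj
    rw [lt_div_iff₀ (by linarith)] at hj
    change _ * m < _
    nlinarith

/-! ### Schedules -/

theorem count_flatMap_replicate {α : Type*} [BEq α] [LawfulBEq α] {l : List α} (hl : l.Nodup)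
    (m : α → ℕ) (a : α) :
    (l.flatMap fun b => List.replicate (m b) b).count a = if a ∈ l then m a else 0 := by
  induction l with
  | nil => simp
  | cons b l ih =>
    rw [List.nodup_cons] at hl
    rw [List.flatMap_cons, List.count_append, ih hl.2, List.count_replicate]
    by_cases hab : b = a
    · subst hab; simp [hl.1]
    · simp [hab, Ne.symm hab]

theorem count_schedule {n : ℕ} (t : Intervention n → ℝ) (a : Intervention n) :
    (schedule t).count a = ⌊t a⌋₊ := by
  rw [schedule, count_flatMap_replicate (Finset.nodup_toList _) (fun a => ⌊t a⌋₊)]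
  simp

theorem length_schedule_le {n : ℕ} {t : Intervention n → ℝ} (ht : ∀ a, 0 ≤ t a) {m : ℕ}
    (h : ∑ a, t a ≤ m) : (schedule t).length ≤ m := by
  have h1 : ((schedule t).length : ℝ) ≤ m := by
    refine le_trans ?_ h
    rw [schedule, List.length_flatMap]
    simp only [List.length_replicate, Finset.sum_map_toList]
    push_cast
    exact Finset.sum_le_sum fun a _ => Nat.floor_le (ht a)
  exact_mod_cast h1

theorem countP_eq_sum {α β : Type*} [Fintype β] [DecidableEq β] (h : List α) (f : α → β)
    (e : α → Prop) [DecidablePred e] :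
    (h.countP fun r => e r) = ∑ b, h.countP fun r => f r = b ∧ e r := by
  induction h with
  | nil => simp
  | cons r h ih =>
    simp only [List.countP_cons, ih, Finset.sum_add_distrib]
    congr 1
    by_cases he : e r
    · simp [he]
    · simp [he]

theorem half_le_floor {x : ℝ} (hx : 1 ≤ x) : x / 2 ≤ (⌊x⌋₊ : ℝ) := by
  have h1 : (1 : ℝ) ≤ (⌊x⌋₊ : ℝ) := by exact_mod_cast Nat.one_le_floor_iff _ |>.2 hx
  have h2 := Nat.lt_floor_add_one x
  linarith

theorem half_le_natDiv {a b : ℕ} (hb : 0 < b) (hab : b ≤ a) : (a : ℝ) / b / 2 ≤ (a / b : ℕ) := by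
  rw [← Nat.floor_div_eq_div (K := ℝ)]
  exact half_le_floor ((one_le_div (by exact_mod_cast hb)).2 (by exact_mod_cast hab))

namespace Model

variable {n k : ℕ} (M : Model n k)

/-- The visits of an intermediate state during a schedule. -/
theorem le_countP_state {rule : List (Round n k) → Fin k → Intervention n}
    {t : Intervention n → ℝ} {h : List (Round n k)}
    (hh : h ∈ (M.play rule (schedule t) []).support) {L : ℝ} (hL : 0 < L) {i : Fin k}
    (ht : ∀ a, 1 ≤ t a) (htP : ∀ a, 0 < M.P a i → 32 * L ≤ t a * M.P a i)
    (hc : ∀ a, Conc L (M.P a i) (h.countP fun r => r.act₀ = a)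
      (h.countP fun r => r.act₀ = a ∧ r.state = i)) :
    (∑ a, t a * M.P a i) / 4 ≤ (h.countP fun r => r.state = i : ℕ) := by
  rw [countP_eq_sum h Round.act₀, Finset.sum_div]
  push_cast
  refine Finset.sum_le_sum fun a _ => ?_
  -- Of the factor 4, one half is lost in rounding `t a` down and one half in the concentration of
  -- the visits.
  have h1 := half_le_floor (ht a)
  have hca := hc a
  rw [M.countP_act₀_of_mem_play hh, count_schedule] at hca
  rcases (M.P_nonneg a i).eq_or_lt with h0 | hpos
  · rw [← h0]; simp
  · have h2 := htP a hpos
    have h3 : t a / 2 * M.P a i ≤ (⌊t a⌋₊ : ℝ) * M.P a i := by gcongr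
    have h4 := hca.half_le hL (by linarith)
    linarith

/-- Invariant of round robin: the intervention at position `j` is used exactly at the visits whose
index is `j` modulo the length. Distinctness of the list ensures that no other position contributes.
-/
theorem countP_roundRobin_eq {L : Fin k → List (Intervention n)} {i : Fin k} (hL : (L i).Nodup)
    {j : ℕ} (hj : j < (L i).length) {acts : List (Intervention n)} {h₀ h : List (Round n k)}
    (h0 : (h₀.countP fun r => r.state = i ∧ r.act = (L i)[j]) =
      (h₀.countP fun r => r.state = i).count (· ≡ j [MOD (L i).length]))
    (hh : h ∈ (M.play (roundRobin L) acts h₀).support) :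
    (h.countP fun r => r.state = i ∧ r.act = (L i)[j]) =
      (h.countP fun r => r.state = i).count (· ≡ j [MOD (L i).length]) := by
  induction acts generalizing h₀ with
  | nil =>
    simp only [Model.play, PMF.support_pure, Set.mem_singleton_iff] at hh
    rwa [hh]
  | cons a as ih =>
    rw [Model.play, PMF.mem_support_bind_iff] at hh
    obtain ⟨r, hr, hh⟩ := hh
    refine ih ?_ hh
    have hact := (M.mem_support_round hr).2
    simp only [List.countP_cons, h0]
    by_cases hs : r.state = i
    · have hlen : (h₀.countP fun r => r.state = i) % (L i).length < (L i).length :=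
        Nat.mod_lt _ (by omega)
      have h1 : r.act = (L i)[(h₀.countP fun r => r.state = i) % (L i).length] := by
        rw [hact, roundRobin, hs, List.getD_eq_getElem _ _ hlen]
      simp only [hs, true_and, decide_true, if_true, Nat.count_succ, h1, hL.getElem_inj_iff,
        Nat.ModEq, Nat.mod_eq_of_lt hj, decide_eq_true_eq]
    · simp [hs]

theorem le_countP_roundRobin {L : Fin k → List (Intervention n)} {i : Fin k} (hL : (L i).Nodup)
    {acts : List (Intervention n)} {h : List (Round n k)}
    (hh : h ∈ (M.play (roundRobin L) acts []).support) {b : Intervention n} (hb : b ∈ L i) :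
    (h.countP fun r => r.state = i) / (L i).length ≤
      h.countP fun r => r.state = i ∧ r.act = b := by
  obtain ⟨j, hj, rfl⟩ := List.getElem_of_mem hb
  rw [M.countP_roundRobin_eq hL hj (by simp) hh, Nat.count_modEq_card _ (by omega)]
  omega

/-! ### The transition probabilities -/

theorem exists_P_pos (a : Intervention n) : ∃ i, 0 < M.P a i := by
  by_contra! hcon
  have := Finset.sum_nonpos fun i (_ : i ∈ Finset.univ) => hcon i
  rw [M.sum_P] at this
  linarith

theorem finite_setOf_P : {p : ℝ | 0 < p ∧ ∃ a i, M.P a i = p}.Finite := by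
  refine (Set.finite_range fun x : Intervention n × Fin k => M.P x.1 x.2).subset ?_
  rintro p ⟨-, a, i, rfl⟩
  exact ⟨(a, i), rfl⟩

theorem pPlus_pos : 0 < M.pPlus := by
  obtain ⟨i, hi⟩ := M.exists_P_pos none
  have hne : {p : ℝ | 0 < p ∧ ∃ a i, M.P a i = p}.Nonempty := ⟨_, hi, _, _, rfl⟩
  exact (hne.csInf_mem M.finite_setOf_P).1

theorem pPlus_le {a : Intervention n} {i : Fin k} (h : 0 < M.P a i) : M.pPlus ≤ M.P a i :=
  csInf_le ⟨0, fun _ hp => hp.1.le⟩ ⟨h, a, i, rfl⟩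

theorem pPlus_le_one : M.pPlus ≤ 1 := by
  obtain ⟨i, hi⟩ := M.exists_P_pos none
  exact (M.pPlus_le hi).trans (M.P_le_one _ _)

open Classical in
/-- The intermediate states that some intervention reaches. -/
def reach : Finset (Fin k) := Finset.univ.filter fun i => ∃ a, 0 < M.P a i

theorem mem_reach {i : Fin k} : i ∈ M.reach ↔ ∃ a, 0 < M.P a i := by simp [reach]

theorem P_eq_zero {i : Fin k} (hi : i ∉ M.reach) (a : Intervention n) : M.P a i = 0 := by
  rw [mem_reach, not_exists] at hi
  exact le_antisymm (not_lt.1 (hi a)) (M.P_nonneg a i)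

/-- The entries of `P` sum to `N`, and the column of each reachable state contributes at least `p₊`.
-/
theorem card_reach_mul_le : (M.reach.card : ℝ) * M.pPlus ≤ (2 * n + 1 : ℕ) := by
  calc (M.reach.card : ℝ) * M.pPlus = ∑ i ∈ M.reach, M.pPlus := by simp
    _ ≤ ∑ i ∈ M.reach, ∑ a, M.P a i := by
        refine Finset.sum_le_sum fun i hi => ?_
        obtain ⟨a, ha⟩ := M.mem_reach.1 hi
        exact (M.pPlus_le ha).trans
          (Finset.single_le_sum (fun a _ => M.P_nonneg a i) (Finset.mem_univ a))
    _ ≤ ∑ i, ∑ a, M.P a i :=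
        Finset.sum_le_sum_of_subset_of_nonneg (Finset.subset_univ _) fun i _ _ =>
          Finset.sum_nonneg fun a _ => M.P_nonneg a i
    _ = _ := by
        rw [Finset.sum_comm]
        simp only [M.sum_P]
        simp [Fintype.card_option]
        ring

/-- Termwise `√P ≤ P / √p₊`, because an entry is either zero or at least `p₊`. This is the source of
`1/p₊` in the term `m₀ / p₊` of the rate. -/
theorem sum_sqrt_P_le (a : Intervention n) : ∑ i, √(M.P a i) ≤ 1 / √M.pPlus := by
  have hp := Real.sqrt_pos.2 M.pPlus_pos
  rw [← M.sum_P a, Finset.sum_div]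
  refine Finset.sum_le_sum fun i _ => ?_
  rcases (M.P_nonneg a i).eq_or_lt with h0 | hpos
  · simp [← h0]
  · rw [le_div_iff₀ hp]
    calc √(M.P a i) * √M.pPlus ≤ √(M.P a i) * √(M.P a i) := by
          gcongr; exact M.pPlus_le hpos
      _ = _ := Real.mul_self_sqrt hpos.le

end Model

/-! ### Consequences of the assumption on the budget -/

/-- The logarithmic factor `log (N T)`. -/
def logNT (n T : ℕ) : ℝ := Real.log (((2 * n + 1 : ℕ) : ℝ) * T)

/-- The assumption on the budget, with an explicit constant. -/
structure Budget {n k : ℕ} (M : Model n k) (T : ℕ) : Prop where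
  n_pos : 1 ≤ n
  T_pos : 1 ≤ T
  key : ∀ i, 100000 * (((2 * n + 1 : ℕ) : ℝ) * M.m i * logNT n T) ≤ T * M.pPlus

namespace Budget

variable {n k : ℕ} {M : Model n k} {T : ℕ}

theorem one_le_log (hB : Budget M T) : 1 ≤ logNT n T := by
  have h1 : (3 : ℝ) ≤ ((2 * n + 1 : ℕ) : ℝ) * T := by
    have := hB.n_pos
    have := hB.T_pos
    exact_mod_cast (show 3 ≤ (2 * n + 1) * T by nlinarith)
  rw [logNT, Real.le_log_iff_exp_le (by linarith)]
  linarith [Real.exp_one_lt_d9]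

theorem one_le_m (hB : Budget M T) (i : Fin k) : (1 : ℝ) ≤ M.m i := by
  exact_mod_cast one_le_causalParam hB.n_pos _

theorem one_le_m₀ (hB : Budget M T) : (1 : ℝ) ≤ M.m₀ := by
  exact_mod_cast one_le_causalParam hB.n_pos _

theorem m₀_le (M : Model n k) : (M.m₀ : ℝ) ≤ (2 * n + 1 : ℕ) := by
  have : M.m₀ ≤ n := causalParam_le _
  exact_mod_cast (show M.m₀ ≤ 2 * n + 1 by omega)

theorem three_le_N (hB : Budget M T) : (3 : ℝ) ≤ (2 * n + 1 : ℕ) := by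
  have := hB.n_pos
  exact_mod_cast (show 3 ≤ 2 * n + 1 by omega)

theorem key_log (hB : Budget M T) :
    100000 * (((2 * n + 1 : ℕ) : ℝ) * logNT n T) ≤ T * M.pPlus := by
  obtain ⟨i, -⟩ := M.exists_P_pos none
  refine le_trans ?_ (hB.key i)
  have h1 := hB.one_le_m i
  have h2 := hB.one_le_log
  have h3 := hB.three_le_N
  have h4 : 0 ≤ ((2 * n + 1 : ℕ) : ℝ) * logNT n T := by positivity
  nlinarith

theorem one_le_T_mul_pPlus (hB : Budget M T) : 1 ≤ T * M.pPlus := by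
  have h1 := hB.key_log
  have h2 := hB.one_le_log
  have h3 := hB.three_le_N
  nlinarith

theorem large (hB : Budget M T) : 100000 * ((2 * n + 1 : ℕ) : ℝ) ≤ T := by
  have h1 := hB.key_log
  have h2 := hB.one_le_log
  have h3 := hB.three_le_N
  have h4 : T * M.pPlus ≤ T := mul_le_of_le_one_right (Nat.cast_nonneg _) M.pPlus_le_one
  nlinarith

theorem T_ge (hB : Budget M T) : 100000 ≤ T := by
  have h1 := hB.large
  have h2 := hB.three_le_N
  exact_mod_cast (show (100000 : ℝ) ≤ T by linarith)

theorem card_reach_le (hB : Budget M T) : M.reach.card ≤ (2 * n + 1) * T := by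
  have h1 := M.card_reach_mul_le
  have h2 := hB.one_le_T_mul_pPlus
  have h3 : (M.reach.card : ℝ) ≤ ((2 * n + 1 : ℕ) : ℝ) * T := by
    calc (M.reach.card : ℝ) ≤ M.reach.card * (T * M.pPlus) :=
          le_mul_of_one_le_right (Nat.cast_nonneg _) h2
      _ = T * (M.reach.card * M.pPlus) := by ring
      _ ≤ T * (2 * n + 1 : ℕ) := by gcongr
      _ = _ := mul_comm _ _
  exact_mod_cast h3

/-- The choice `L = 4 log(NT)` is made here: at most `N²T` instances with at most `5T` exponents
each, against `exp (-L) = (NT)⁻⁴`, leave `5/(N²T²) ≤ 5/T`. -/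
theorem mul_failProb_le (hB : Budget M T) {m l : ℕ} (hm : m ≤ (2 * n + 1) * ((2 * n + 1) * T))
    (hl : l + 1 ≤ T) : (m : ℝ≥0∞) * failProb (4 * logNT n T) l ≤ ENNReal.ofReal (5 / T) := by
  have hT : (1 : ℝ) ≤ T := by exact_mod_cast hB.T_pos
  have hN := hB.three_le_N
  set N : ℝ := ((2 * n + 1 : ℕ) : ℝ) with hNdef
  have hexp : Real.exp (-(4 * logNT n T)) = ((N * T) ^ 4)⁻¹ := by
    rw [Real.exp_neg, logNT, ← hNdef, show (4 : ℝ) = ((4 : ℕ) : ℝ) by norm_num, Real.exp_nat_mul,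
      Real.exp_log (by positivity)]
  rw [failProb, hexp, ← ENNReal.ofReal_natCast, ← ENNReal.ofReal_natCast,
    ← ENNReal.ofReal_mul (by positivity), ← ENNReal.ofReal_mul (by positivity)]
  refine ENNReal.ofReal_le_ofReal ?_
  have h1 : (m : ℝ) ≤ N * (N * T) := by rw [hNdef]; exact_mod_cast hm
  have h2 : ((5 * (l + 1) : ℕ) : ℝ) ≤ 5 * T := by exact_mod_cast Nat.mul_le_mul_left 5 hl
  calc (m : ℝ) * ((5 * (l + 1) : ℕ) * ((N * T) ^ 4)⁻¹)
      ≤ N * (N * T) * (5 * T * ((N * T) ^ 4)⁻¹) := by gcongr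
    _ = 5 / T * (1 / (N ^ 2 * T)) := by field_simp
    _ ≤ 5 / T * 1 := by
        gcongr
        rw [div_le_one (by positivity)]
        nlinarith [mul_le_mul hN hN (by norm_num) (by linarith)]
    _ = 5 / T := mul_one _

theorem T_div_four_le (hB : Budget M T) : (T : ℝ) / 4 ≤ (T / 3 : ℕ) := by
  have h := hB.T_ge
  have h1 : T ≤ 4 * (T / 3) := by omega
  have h2 : (T : ℝ) ≤ 4 * (T / 3 : ℕ) := by exact_mod_cast h1
  linarith

end Budget

/-! ### Combining failure probabilities, and samples that agree with an intervention -/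

theorem toOuterMeasure_not_and_le {α : Type*} (p : PMF α) {A B : α → Prop} {x y : ℝ}
    (hx : 0 ≤ x) (hy : 0 ≤ y)
    (hA : p.toOuterMeasure {z | ¬ A z} ≤ ENNReal.ofReal x)
    (hB : p.toOuterMeasure {z | ¬ B z} ≤ ENNReal.ofReal y) :
    p.toOuterMeasure {z | ¬ (A z ∧ B z)} ≤ ENNReal.ofReal (x + y) := by
  rw [ENNReal.ofReal_add hx hy]
  refine (MeasureTheory.measure_mono ?_).trans
    ((MeasureTheory.measure_union_le _ _).trans (add_le_add hA hB))
  intro z hz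
  by_cases h : A z
  · exact Or.inr fun hb => hz ⟨h, hb⟩
  · exact Or.inl h

/-- Lets each stage of the algorithm be analysed for a fixed good outcome of the preceding one. -/
theorem toOuterMeasure_bind_le_add {α β : Type*} (p : PMF α) (g : α → PMF β) {A : α → Prop}
    {B : β → Prop} {x y : ℝ} (hx : 0 ≤ x) (hy : 0 ≤ y)
    (hA : p.toOuterMeasure {z | ¬ A z} ≤ ENNReal.ofReal x)
    (hB : ∀ z ∈ p.support, A z → (g z).toOuterMeasure {w | ¬ B w} ≤ ENNReal.ofReal y) :
    (p.bind g).toOuterMeasure {w | ¬ B w} ≤ ENNReal.ofReal (x + y) := by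
  rw [ENNReal.ofReal_add hx hy]
  exact (toOuterMeasure_bind_le p g _ _ fun z hz hA => hB z hz (not_not.1 hA)).trans
    (add_le_add_left hA _)

/-- A deterministic function of a random outcome. -/
theorem toOuterMeasure_bind_pure_le {α β : Type*} (p : PMF α) (g : α → β) {A : α → Prop}
    {B : β → Prop} {x : ℝ} (hx : 0 ≤ x)
    (hA : p.toOuterMeasure {z | ¬ A z} ≤ ENNReal.ofReal x)
    (hB : ∀ z ∈ p.support, A z → B (g z)) :
    (p.bind fun z => PMF.pure (g z)).toOuterMeasure {w | ¬ B w} ≤ ENNReal.ofReal x := by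
  rw [← add_zero x]
  refine toOuterMeasure_bind_le_add p _ hx le_rfl hA fun z hz hz' => ?_
  rw [toOuterMeasure_pure_eq_zero (by simpa using hB z hz hz')]
  exact zero_le

/-- A deterministic statement: the rare set is computed from the same rounds in which agreement is
counted, so the lower bound on empirical frequencies is itself the bound on the count. -/
theorem le_countP_agrees {α : Type} {n : ℕ} {h : List α} {c : α → Prop} [DecidablePred c]
    {X : α → Fin n → Bool} {b : Intervention n}
    (hb : b ∉ rareInterventions fun j => freq h c fun r => X r j = true) :
    ((h.countP fun r => c r : ℕ) : ℝ) /
      ((causalParam fun j => freq h c fun r => X r j = true : ℕ) + 1) ≤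
      (h.countP fun r => c r ∧ Agrees b (X r) : ℕ) := by
  rcases Nat.eq_zero_or_pos (h.countP fun r => c r) with h0 | hpos
  · rw [h0]; simp
  rcases b with _ | ⟨j, y⟩
  · have : (h.countP fun r => c r ∧ Agrees none (X r)) = h.countP fun r => c r :=
      List.countP_congr fun r _ => by simp [Agrees]
    rw [this]
    refine div_le_self (Nat.cast_nonneg _) ?_
    linarith [Nat.cast_nonneg (α := ℝ) (causalParam fun j => freq h c fun r => X r j = true)]
  · have : (h.countP fun r => c r ∧ Agrees (some (j, y)) (X r)) =
        h.countP fun r => c r ∧ X r j = y :=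
      List.countP_congr fun r _ => by simp [Agrees]
    rw [this]
    have h1 := le_valProb_of_notMem hb
    have h2 : (0 : ℝ) < (h.countP fun r => c r : ℕ) := by exact_mod_cast hpos
    rw [freq_not h c (fun r => X r j) hpos, freq, le_div_iff₀ h2] at h1
    refine le_trans (le_of_eq ?_) h1
    ring

/-! ### First subroutine -/

/-- The entry `x` is a good estimate of the transition probability `P_(a,i)`. -/
def TransClose {n k : ℕ} (M : Model n k) (T : ℕ) (a : Intervention n) (i : Fin k) (x : ℝ) : Prop :=
  (M.P a i = 0 → x = 0) ∧ |x - M.P a i| ≤ 2 * √(M.P a i * (192 * M.m₀ * logNT n T) / T) ∧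
    M.P a i ≤ 2 * x ∧ x ≤ 2 * M.P a i

/-- For positive entries the budget makes `P` times the sample size at least `16 L`, so the error is
at most `P/2` and the estimate is within a factor 2. The constant is `192 = 4 · 48`, from `L = 4
log(NT)` and the sample size `T/(48 m₀)`. -/
theorem transClose_freq {n k : ℕ} {M : Model n k} {T : ℕ} (hB : Budget M T)
    {h : List (Round n k)} {c : Round n k → Prop} [DecidablePred c] {a : Intervention n} {i : Fin k}
    (hc : 0 < M.P a i → Conc (4 * logNT n T) (M.P a i) (h.countP fun r => c r)
      (h.countP fun r => c r ∧ r.state = i))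
    (hN : (T : ℝ) / (48 * M.m₀) ≤ (h.countP fun r => c r : ℕ))
    (hz : ∀ r ∈ h, c r → r.state = i → M.P a i ≠ 0) :
    TransClose M T a i (freq h c fun r => r.state = i) := by
  rcases (M.P_nonneg a i).eq_or_lt with h0 | hpos
  · have : (h.countP fun r => c r ∧ r.state = i) = 0 := by
      rw [List.countP_eq_zero]
      intro r hr
      simp only [decide_eq_true_eq, not_and]
      exact fun h1 h2 => hz r hr h1 h2 h0.symm
    have hf : freq h c (fun r => r.state = i) = 0 := by rw [freq, this]; simp
    simp [TransClose, hf, ← h0]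
  · have hm := hB.one_le_m₀
    have hl := hB.one_le_log
    have hT : (1 : ℝ) ≤ T := by exact_mod_cast hB.T_pos
    have h1 : 16 * (4 * logNT n T) ≤ T / (48 * M.m₀) * M.P a i := by
      rw [div_mul_eq_mul_div, le_div_iff₀ (by linarith)]
      have h2 := hB.key_log
      have h3 : T * M.pPlus ≤ T * M.P a i := by gcongr; exact M.pPlus_le hpos
      have h4 : (M.m₀ : ℝ) * logNT n T ≤ (2 * n + 1 : ℕ) * logNT n T := by
        exact mul_le_mul_of_nonneg_right (Budget.m₀_le M) (by linarith)
      nlinarith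
    have h2 := (hc hpos).freq_close (by linarith) hN hpos.le (by linarith)
    have h3 := two_sqrt_le_half (by linarith) hpos h1
    have h4 := abs_le.1 (h2.trans h3)
    refine ⟨fun h => absurd h hpos.ne', h2.trans_eq ?_, by linarith, by linarith⟩
    congr 2
    field_simp
    ring

/-- All the estimated transition probabilities are good. -/
def TransGood {n k : ℕ} (M : Model n k) (T : ℕ) (P' : Matrix (Intervention n) (Fin k) ℝ) : Prop :=
  ∀ a i, TransClose M T a i (P' a i)

theorem card_intervention (n : ℕ) : Fintype.card (Intervention n) = 2 * n + 1 := by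
  simp [Fintype.card_option]; ring

theorem length_flatMap_replicate_const {α : Type*} (l : List α) (m : ℕ) :
    (l.flatMap fun a => List.replicate m a).length = l.length * m := by
  simp [List.length_flatMap]

theorem estimateTransitions_good {n k : ℕ} {M : Model n k} {T : ℕ} (hB : Budget M T) :
    (estimateTransitions M (T / 3)).toOuterMeasure {P' | ¬ TransGood M T P'} ≤
      ENNReal.ofReal (15 / T) := by
  have hT := hB.T_ge
  have hT0 : (0 : ℝ) < T := by exact_mod_cast hB.T_pos
  have hm := hB.one_le_m₀
  have hl := hB.one_le_log
  have hn := hB.n_pos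
  set Λ := logNT n T with hΛ
  have hcard : (Finset.univ ×ˢ M.reach : Finset (Intervention n × Fin k)).card ≤
      (2 * n + 1) * ((2 * n + 1) * T) := by
    rw [Finset.card_product, Finset.card_univ, card_intervention]
    exact Nat.mul_le_mul_left _ hB.card_reach_le
  have hq := (M.play_forall_conc doNothing (List.replicate (T / 3 / 2) none)
    (Finset.univ : Finset (Fin n × Bool)) (fun _ _ => True) (fun z r => r.x₀ z.1 = z.2)
    (p := fun z => valProb (M.q₀ z.1) z.2) (fun z => valProb_nonneg _ _)
    (fun z => valProb_le_one _ _) (fun z a ha h => by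
      rw [(List.mem_replicate.1 ha).2]; exact M.condBern_x₀ _ _ _)
    (L := 4 * Λ) (by linarith)).trans (hB.mul_failProb_le (by
      simp only [Finset.card_univ, Fintype.card_prod, Fintype.card_fin, Fintype.card_bool]
      calc n * 2 ≤ (2 * n + 1) * 1 := by omega
        _ ≤ _ := Nat.mul_le_mul_left _ (Nat.mul_pos (by omega) hB.T_pos)) (by simp; omega))
  have hP := (M.play_forall_conc doNothing (List.replicate (T / 3 / 2) none)
    (Finset.univ ×ˢ M.reach) (fun z r => Agrees z.1 r.x₀) (fun z r => r.state = z.2)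
    (p := fun z => M.P z.1 z.2) (fun z => M.P_nonneg _ _) (fun z => M.P_le_one _ _)
    (fun z a ha h => by
      rw [(List.mem_replicate.1 ha).2]; exact M.condBern_state_of_agrees _ _ _)
    (L := 4 * Λ) (by linarith)).trans (hB.mul_failProb_le hcard (by simp; omega))
  rw [show (15 : ℝ) / T = (5 / T + 5 / T) + 5 / T by ring]
  refine toOuterMeasure_bind_le_add _ _ (by positivity) (by positivity)
    (toOuterMeasure_not_and_le _ (by positivity) (by positivity) hq hP) ?_
  rintro h hh ⟨hq1, hP1⟩
  have hlen : h.length = T / 3 / 2 := by simpa using M.length_of_mem_play hh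
  have hcnt : (h.countP fun _ => decide True) = T / 3 / 2 := by simp [hlen]
  have hN1 : (T : ℝ) / 10 ≤ (T / 3 / 2 : ℕ) := by
    have : T ≤ 10 * (T / 3 / 2) := by omega
    have : (T : ℝ) ≤ 10 * (T / 3 / 2 : ℕ) := by exact_mod_cast this
    linarith
  have hmm₀ : (M.m₀ : ℝ) * Λ ≤ (2 * n + 1 : ℕ) * Λ :=
    mul_le_mul_of_nonneg_right (Budget.m₀_le M) (by linarith)
  have hTp : T * M.pPlus ≤ T := mul_le_of_le_one_right (Nat.cast_nonneg _) M.pPlus_le_one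
  have hkey := hB.key_log
  have hm' := (causalParam_freq hn (h := h) (c := fun _ => True) (X := fun r => r.x₀)
    (q := fun j => (M.q₀ j : ℝ)) (L := 4 * Λ) (by linarith)
    (fun j y => hq1 (j, y) (Finset.mem_univ _)) (by
      rw [hcnt]
      change 16 * (4 * Λ) * ((M.m₀ : ℝ) + 1) ≤ _
      nlinarith)).1
  change causalParam (qHat₀ h) ≤ 3 * M.m₀ at hm'
  have hm'1 : 1 ≤ causalParam (qHat₀ h) := one_le_causalParam hn _
  set L := rareInterventions (qHat₀ h) with hL
  have hLlen : L.length = causalParam (qHat₀ h) := length_rareInterventions _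
  have hlen2 : (L.flatMap fun a => List.replicate (T / 3 / (2 * L.length)) a).length + 1 ≤ T := by
    rw [length_flatMap_replicate_const, mul_comm 2, ← Nat.div_div_eq_div_mul]
    have h1 := Nat.mul_div_le (T / 3) L.length
    have h2 : L.length * (T / 3 / L.length / 2) ≤ L.length * (T / 3 / L.length) :=
      Nat.mul_le_mul_left _ (Nat.div_le_self _ _)
    omega
  have hS := (M.play_forall_conc doNothing
    (L.flatMap fun a => List.replicate (T / 3 / (2 * L.length)) a)
    (Finset.univ ×ˢ M.reach) (fun z r => r.act₀ = z.1) (fun z r => r.state = z.2)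
    (p := fun z => M.P z.1 z.2) (fun z => M.P_nonneg _ _) (fun z => M.P_le_one _ _)
    (fun z a ha h => M.condBern_state _ _ _ _)
    (L := 4 * Λ) (by linarith)).trans (hB.mul_failProb_le hcard hlen2)
  refine toOuterMeasure_bind_pure_le _ (pHat L h) (by positivity) hS ?_
  intro h' hh' hS1 a i
  simp only [pHat, Matrix.of_apply]
  have hm'r : (causalParam (qHat₀ h) : ℝ) ≤ 3 * M.m₀ := by exact_mod_cast hm'
  by_cases ha : a ∈ L
  · rw [if_pos ha]
    refine transClose_freq hB (fun hpos => hS1 (a, i) ?_) ?_ ?_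
    · exact Finset.mem_product.2 ⟨Finset.mem_univ _, M.mem_reach.2 ⟨a, hpos⟩⟩
    · rw [M.countP_act₀_of_mem_play hh',
        count_flatMap_replicate (nodup_rareInterventions _) (fun _ => T / 3 / (2 * L.length)),
        if_pos ha]
      have h1 : 2 * L.length ≤ T / 3 := by
        rw [hLlen]
        have : causalParam (qHat₀ h) ≤ n := causalParam_le _
        have h2 : 100000 * (2 * n + 1) ≤ T := by exact_mod_cast hB.large
        omega
      -- With `T' ≥ T/4` and an estimated parameter at most `3m₀`, the share is at least half of
      -- `(T/4)/(6m₀)`; this is where 48 comes from.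
      refine le_trans ?_ (half_le_natDiv (by omega) h1)
      have h3 := hB.T_div_four_le
      have h4 : (0 : ℝ) < causalParam (qHat₀ h) := by exact_mod_cast hm'1
      rw [hLlen, div_div, div_le_div_iff₀ (by linarith) (by push_cast; linarith)]
      push_cast
      have h5 := mul_le_mul_of_nonneg_left hm'r hT0.le
      have h6 := mul_le_mul_of_nonneg_right h3 (show (0 : ℝ) ≤ M.m₀ by linarith)
      linarith
    · intro r hr hra hri
      rcases M.exists_round_of_mem_play hh' hr with h0 | ⟨b, -, g, hg⟩
      · simp at h0
      · exact (M.condBern_state a b i _).ne_zero hg hra hri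
  · rw [if_neg ha]
    refine transClose_freq hB (fun hpos => hP1 (a, i) ?_) ?_ ?_
    · exact Finset.mem_product.2 ⟨Finset.mem_univ _, M.mem_reach.2 ⟨a, hpos⟩⟩
    · have h1 := le_countP_agrees (h := h) (c := fun _ => True) (X := fun r => r.x₀) ha
      rw [hcnt] at h1
      change _ / ((causalParam (qHat₀ h) : ℝ) + 1) ≤ _ at h1
      have h2 : (h.countP fun r => True ∧ Agrees a r.x₀) = h.countP fun r => Agrees a r.x₀ :=
        List.countP_congr fun r _ => by simp
      rw [h2] at h1
      refine le_trans ?_ h1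
      -- Here `(T/10)/(3m₀ + 1) ≥ T/(40m₀)`, as `m₀ ≥ 1`.
      rw [div_le_div_iff₀ (by linarith) (by positivity)]
      nlinarith
    · intro r hr hra hri
      rcases M.exists_round_of_mem_play hh hr with h0 | ⟨b, hb, g, hg⟩
      · simp at h0
      · rw [(List.mem_replicate.1 hb).2] at hg
        exact (M.condBern_state_of_agrees a i _).ne_zero hg hra hri

theorem Budget.card_univ_prod_reach_le {n k : ℕ} {M : Model n k} {T : ℕ} (hB : Budget M T) :
    (Finset.univ ×ˢ M.reach : Finset (Intervention n × Fin k)).card ≤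
      (2 * n + 1) * ((2 * n + 1) * T) := by
  rw [Finset.card_product, Finset.card_univ, card_intervention]
  exact Nat.mul_le_mul_left _ hB.card_reach_le

theorem Budget.card_reach_prod_le {n k : ℕ} {M : Model n k} {T : ℕ} (hB : Budget M T) :
    (M.reach ×ˢ Finset.univ : Finset (Fin k × Fin n × Bool)).card ≤
      (2 * n + 1) * ((2 * n + 1) * T) := by
  rw [Finset.card_product, mul_comm, Finset.card_univ]
  refine Nat.mul_le_mul ?_ hB.card_reach_le
  simp only [Fintype.card_prod, Fintype.card_fin, Fintype.card_bool]
  omega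

theorem sum_const_N (n : ℕ) : ∑ _a : Intervention n, 1 / (2 * (n : ℝ) + 1) = 1 := by
  rw [Finset.sum_const, Finset.card_univ, card_intervention, nsmul_eq_mul]
  push_cast
  field_simp

/-! ### Second subroutine -/

/-- The estimated causal parameters are of the right order at all reachable states. -/
def CausalGood {n k : ℕ} (M : Model n k) (m' : Fin k → ℕ) : Prop :=
  ∀ i ∈ M.reach, m' i ≤ 3 * M.m i ∧ M.m i ≤ 5 * m' i

/-- Estimation of the causal parameters from rounds with `do()` at the intermediate states. -/
theorem play_causalParam {n k : ℕ} {M : Model n k} {T : ℕ} (hB : Budget M T)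
    {t : Intervention n → ℝ} (ht : ∀ a, T / (24 * ((2 * n + 1 : ℕ) : ℝ)) ≤ t a)
    (hsum : ∑ a, t a ≤ (T / 3 : ℕ)) :
    (M.play doNothing (schedule t) []).toOuterMeasure {h | ¬ ∀ i ∈ M.reach,
      (∑ a, t a * M.P a i) / 4 ≤ (h.countP fun r => r.state = i : ℕ) ∧
      causalParam (qHat h i) ≤ 3 * M.m i ∧ M.m i ≤ 5 * causalParam (qHat h i)} ≤
      ENNReal.ofReal (10 / T) := by
  have hl := hB.one_le_log
  have hN := hB.three_le_N
  have hT := hB.T_ge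
  have hT0 : (0 : ℝ) < T := by exact_mod_cast hB.T_pos
  set N : ℝ := ((2 * n + 1 : ℕ) : ℝ) with hNdef
  set Λ := logNT n T with hΛ
  have hlarge := hB.large
  have ht1 : ∀ a, 1 ≤ t a := fun a => by
    refine le_trans ?_ (ht a)
    rw [le_div_iff₀ (by positivity)]
    linarith
  have hlen : (schedule t).length + 1 ≤ T := by
    have := length_schedule_le (fun a => zero_le_one.trans (ht1 a)) hsum
    omega
  have hP := (M.play_forall_conc doNothing (schedule t)
    (Finset.univ ×ˢ M.reach) (fun z r => r.act₀ = z.1) (fun z r => r.state = z.2)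
    (p := fun z => M.P z.1 z.2) (fun z => M.P_nonneg _ _) (fun z => M.P_le_one _ _)
    (fun z a ha h => M.condBern_state _ _ _ _)
    (L := 4 * Λ) (by linarith)).trans (hB.mul_failProb_le hB.card_univ_prod_reach_le hlen)
  have hX := (M.play_forall_conc doNothing (schedule t)
    (M.reach ×ˢ Finset.univ) (fun z r => r.state = z.1) (fun z r => r.x z.2.1 = z.2.2)
    (p := fun z => valProb (M.q z.1 z.2.1) z.2.2) (fun z => valProb_nonneg _ _)
    (fun z => valProb_le_one _ _) (fun z a ha h => M.condBern_x _ _ _ _)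
    (L := 4 * Λ) (by linarith)).trans (hB.mul_failProb_le hB.card_reach_prod_le hlen)
  rw [show (10 : ℝ) / T = 5 / T + 5 / T by ring]
  refine le_trans (PMF.toOuterMeasure_mono _ ?_)
    (toOuterMeasure_not_and_le _ (by positivity) (by positivity) hP hX)
  rintro h ⟨hh, hsupp⟩ ⟨hP1, hX1⟩
  refine hh fun i hi => ?_
  have hm := hB.one_le_m i
  have hTP : ∀ a, 0 < M.P a i → 100000 * (N * M.m i * Λ) ≤ T * M.P a i := fun a hpos =>
    (hB.key i).trans (by gcongr; exact M.pPlus_le hpos)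
  have htP : ∀ a, 0 < M.P a i → 4000 * (M.m i * Λ) ≤ t a * M.P a i := fun a hpos => by
    -- Only 96000 of the 100000 in the budget is used, so that the division by 24 is exact.
    calc 4000 * (M.m i * Λ) = 96000 * (N * M.m i * Λ) / (24 * N) := by field_simp; ring
      _ ≤ T * M.P a i / (24 * N) := by
          refine div_le_div_of_nonneg_right ?_ (by positivity)
          have : 0 ≤ N * M.m i * Λ := by positivity
          linarith [hTP a hpos]
      _ = T / (24 * N) * M.P a i := by ring
      _ ≤ _ := by gcongr; exact ht a
  have hmΛ : Λ ≤ M.m i * Λ := le_mul_of_one_le_left (by linarith) hm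
  have hvis := M.le_countP_state hsupp (L := 4 * Λ) (by linarith) ht1
    (fun a hpos => by linarith [htP a hpos])
    (fun a => hP1 (a, i) (Finset.mem_product.2 ⟨Finset.mem_univ _, hi⟩))
  -- One intervention that reaches `i` already provides enough visits, thanks to its uniform share
  -- of the rounds.
  obtain ⟨a₀, ha₀⟩ := M.mem_reach.1 hi
  have hone : t a₀ * M.P a₀ i ≤ ∑ a, t a * M.P a i :=
    Finset.single_le_sum (fun a _ => mul_nonneg (zero_le_one.trans (ht1 a)) (M.P_nonneg a i))
      (Finset.mem_univ a₀)
  refine ⟨hvis, causalParam_freq hB.n_pos (h := h) (c := fun r => r.state = i) (X := fun r => r.x)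
    (q := fun j => (M.q i j : ℝ)) (L := 4 * Λ) (by linarith)
    (fun j y => hX1 (i, j, y) (Finset.mem_product.2 ⟨hi, Finset.mem_univ _⟩)) ?_⟩
  change 16 * (4 * Λ) * ((M.m i : ℝ) + 1) ≤ _
  have := htP a₀ ha₀
  linarith

theorem estimateCausalParams_good {n k : ℕ} {M : Model n k} {T : ℕ} (hB : Budget M T)
    {ft : Intervention n → ℝ} (hft : ft ∈ stdSimplex ℝ (Intervention n)) :
    (estimateCausalParams M ft (T / 3)).toOuterMeasure {m' | ¬ CausalGood M m'} ≤
      ENNReal.ofReal (10 / T) := by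
  have hT4 := hB.T_div_four_le
  have hN := hB.three_le_N
  have hNe : ((2 * n + 1 : ℕ) : ℝ) = 2 * n + 1 := by push_cast; ring
  have hT0 : (0 : ℝ) < T := by exact_mod_cast hB.T_pos
  refine toOuterMeasure_bind_pure_le _ _ (by positivity) (play_causalParam hB ?_ ?_)
    fun h _ hh i hi => (hh i hi).2
  · intro a
    rw [hNe] at hN ⊢
    have := hft.1 a
    -- This schedule gives each intervention at least `T/(8N)`; the weaker `T/(24N)` is what the
    -- third subroutine can also guarantee.
    calc (T : ℝ) / (24 * (2 * n + 1)) ≤ T / 4 * ((1 / 2) * (0 + 1 / (2 * n + 1))) := by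
          rw [div_le_iff₀ (by positivity)]; field_simp; norm_num
      _ ≤ _ := by beta_reduce; gcongr
  · rw [← Finset.mul_sum, ← Finset.mul_sum, Finset.sum_add_distrib, hft.2, sum_const_N]
    norm_num

/-! ### Third subroutine -/

/-- The frequency vector of the third subroutine. -/
def mixFreq {n : ℕ} (fs ft : Intervention n → ℝ) : Intervention n → ℝ :=
  fun a => (1 / 3) * (fs a + ft a + 1 / (2 * n + 1))

theorem mixFreq_mem {n : ℕ} {fs ft : Intervention n → ℝ}
    (hfs : fs ∈ stdSimplex ℝ (Intervention n)) (hft : ft ∈ stdSimplex ℝ (Intervention n)) :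
    mixFreq fs ft ∈ stdSimplex ℝ (Intervention n) := by
  refine ⟨fun a => ?_, ?_⟩
  · have := hfs.1 a
    have := hft.1 a
    simp only [mixFreq]
    positivity
  · simp only [mixFreq]
    rw [← Finset.mul_sum, Finset.sum_add_distrib, Finset.sum_add_distrib, hfs.2, hft.2, sum_const_N]
    norm_num

/-- The estimated mean rewards are good at all reachable states, when the start-state interventions
were performed with frequencies `f`. -/
def RewardGood {n k : ℕ} (M : Model n k) (T : ℕ) (f : Intervention n → ℝ)
    (R' : Fin k → Intervention n → ℝ) : Prop :=
  ∀ i, (∀ b, 0 ≤ R' i b ∧ R' i b ≤ 1) ∧ (i ∈ M.reach → ∀ b,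
    |R' i b - M.meanReward i b| ≤ 2 * √(768 * M.m i * logNT n T / (T * (M.Pᵀ *ᵥ f) i)))

theorem le_mulVec {n k : ℕ} (M : Model n k) {f : Intervention n → ℝ} (hf : ∀ a, 0 ≤ f a)
    (a : Intervention n) (i : Fin k) : f a * M.P a i ≤ (M.Pᵀ *ᵥ f) i := by
  rw [Matrix.mulVec, dotProduct, mul_comm]
  exact Finset.single_le_sum (f := fun a => M.P a i * f a)
    (fun a _ => mul_nonneg (M.P_nonneg a i) (hf a)) (Finset.mem_univ a)

/-- State `i` gets at least `T (Pᵀf)ᵢ / 32` visits in each half, and every intervention there a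
share of at least `1/(6mᵢ)` of that bound: by agreement in the first half, by round robin in the
second. -/
theorem estimateRewards_good {n k : ℕ} {M : Model n k} {T : ℕ} (hB : Budget M T)
    {fs ft : Intervention n → ℝ} (hfs : fs ∈ stdSimplex ℝ (Intervention n))
    (hft : ft ∈ stdSimplex ℝ (Intervention n)) :
    (estimateRewards M fs ft (T / 3)).toOuterMeasure {R' | ¬ RewardGood M T (mixFreq fs ft) R'} ≤
      ENNReal.ofReal (30 / T) := by
  have hl := hB.one_le_log
  have hN := hB.three_le_N
  have hT := hB.T_ge
  have hT0 : (0 : ℝ) < T := by exact_mod_cast hB.T_pos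
  have hNe : ((2 * n + 1 : ℕ) : ℝ) = 2 * n + 1 := by push_cast; ring
  have hT4 := hB.T_div_four_le
  have hlarge := hB.large
  have hmix := mixFreq_mem hfs hft
  set f := mixFreq fs ft with hf
  set N : ℝ := ((2 * n + 1 : ℕ) : ℝ) with hNdef
  set Λ := logNT n T with hΛ
  set t : Intervention n → ℝ := fun a => f a * (T / 3 : ℕ) / 2 with htdef
  have hfN : ∀ a, 1 / (3 * N) ≤ f a := fun a => by
    have h1 := hfs.1 a
    have h2 := hft.1 a
    calc 1 / (3 * N) = (1 / 3) * (0 + 0 + 1 / (2 * n + 1)) := by rw [hNe]; field_simp; ring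
      _ ≤ _ := by rw [hf, mixFreq]; gcongr
  have htf : ∀ a, f a * T / 8 ≤ t a := fun a => by
    have := mul_le_mul_of_nonneg_left hT4 (hmix.1 a)
    simp only [htdef]; linarith
  have htN : ∀ a, T / (24 * N) ≤ t a := fun a => by
    refine le_trans ?_ (htf a)
    calc T / (24 * N) = 1 / (3 * N) * T / 8 := by field_simp; ring
      _ ≤ _ := by gcongr; exact hfN a
  have ht1 : ∀ a, 1 ≤ t a := fun a => by
    refine le_trans ?_ (htN a)
    rw [le_div_iff₀ (by positivity)]
    linarith
  have hsum : ∑ a, t a ≤ (T / 3 : ℕ) := by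
    simp only [htdef]
    rw [← Finset.sum_div, ← Finset.sum_mul, hmix.2]
    linarith
  have hlen : (schedule t).length + 1 ≤ T := by
    have := length_schedule_le (fun a => zero_le_one.trans (ht1 a)) hsum
    omega
  -- Here `32 = 8 · 4`: `t a ≥ f a * T / 8`, and `le_countP_state` loses a factor 4.
  set W : Fin k → ℝ := fun i => T * (M.Pᵀ *ᵥ f) i / 32 with hW
  have hWt : ∀ i, W i ≤ (∑ a, t a * M.P a i) / 4 := fun i => by
    simp only [hW, Matrix.mulVec, dotProduct, Matrix.transpose_apply]
    rw [Finset.mul_sum, Finset.sum_div, Finset.sum_div]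
    refine Finset.sum_le_sum fun a _ => ?_
    have := mul_le_mul_of_nonneg_right (htf a) (M.P_nonneg a i)
    linarith
  have hTP : ∀ a i, 0 < M.P a i → 100000 * (N * M.m i * Λ) ≤ T * M.P a i := fun a i hpos =>
    (hB.key i).trans (by gcongr; exact M.pPlus_le hpos)
  have hWm : ∀ i ∈ M.reach, 1000 * (M.m i * Λ) ≤ W i := fun i hi => by
    have hm := hB.one_le_m i
    obtain ⟨a, ha⟩ := M.mem_reach.1 hi
    have h1 := le_mulVec M hmix.1 a i
    calc 1000 * (M.m i * Λ) = 96000 * (N * M.m i * Λ) / (3 * N) / 32 := by field_simp; ring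
      _ ≤ T * M.P a i / (3 * N) / 32 := by
          refine div_le_div_of_nonneg_right (div_le_div_of_nonneg_right ?_ (by positivity))
            (by norm_num)
          have : 0 ≤ N * M.m i * Λ := by positivity
          linarith [hTP a i ha]
      _ = T * (1 / (3 * N) * M.P a i) / 32 := by ring
      _ ≤ T * (f a * M.P a i) / 32 := by gcongr; exact hfN a
      _ ≤ _ := by simp only [hW]; gcongr
  -- The constant is `768 = 4 · 6 · 32`, from `L = 4Λ` and the sample size `W i / (6 mᵢ)`.
  have hkey : ∀ (h : List (Round n k)) (c : Round n k → Prop) [DecidablePred c] (i : Fin k)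
      (b : Intervention n), i ∈ M.reach →
      Conc (4 * Λ) (M.meanReward i b) (h.countP fun r => c r)
        (h.countP fun r => c r ∧ r.reward = true) →
      W i / (6 * M.m i) ≤ (h.countP fun r => c r : ℕ) →
      |freq h c (fun r => r.reward = true) - M.meanReward i b| ≤
        2 * √(768 * M.m i * Λ / (T * (M.Pᵀ *ᵥ f) i)) := by
    intro h c _ i b hi hc hcnt
    have hm := hB.one_le_m i
    have h1 := hWm i hi
    refine (hc.freq_close' (by linarith) hcnt ?_).trans_eq ?_
    · rw [le_div_iff₀ (by linarith)]
      nlinarith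
    · congr 2
      simp only [hW]
      rw [div_div_eq_mul_div, div_div_eq_mul_div]
      congr 1; ring
  have hcardb : (M.reach ×ˢ Finset.univ : Finset (Fin k × Intervention n)).card ≤
      (2 * n + 1) * ((2 * n + 1) * T) := by
    rw [Finset.card_product, mul_comm, Finset.card_univ, card_intervention]
    exact Nat.mul_le_mul_left _ hB.card_reach_le
  have hR1 := (M.play_forall_conc doNothing (schedule t)
    (M.reach ×ˢ Finset.univ) (fun z r => r.state = z.1 ∧ Agrees z.2 r.x) (fun z r => r.reward = true)
    (p := fun z => M.meanReward z.1 z.2) (fun z => M.meanReward_nonneg _ _)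
    (fun z => M.meanReward_le_one _ _) (fun z a ha h => M.condBern_reward_of_agrees _ _ _)
    (L := 4 * Λ) (by linarith)).trans (hB.mul_failProb_le hcardb hlen)
  rw [show (30 : ℝ) / T = (10 / T + 5 / T) + (10 / T + 5 / T) by ring]
  refine toOuterMeasure_bind_le_add _ _ (by positivity) (by positivity)
    (toOuterMeasure_not_and_le _ (by positivity) (by positivity)
      (play_causalParam hB htN hsum) hR1) ?_
  rintro h hh ⟨hV, hR1⟩
  set L : Fin k → List (Intervention n) := fun i => rareInterventions (qHat h i) with hL
  have hR2 := (M.play_forall_conc (roundRobin L) (schedule t)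
    (M.reach ×ˢ Finset.univ) (fun z r => r.state = z.1 ∧ r.act = z.2) (fun z r => r.reward = true)
    (p := fun z => M.meanReward z.1 z.2) (fun z => M.meanReward_nonneg _ _)
    (fun z => M.meanReward_le_one _ _) (fun z a ha h => M.condBern_reward _ _ _ _)
    (L := 4 * Λ) (by linarith)).trans (hB.mul_failProb_le hcardb hlen)
  have hP2 := (M.play_forall_conc (roundRobin L) (schedule t)
    (Finset.univ ×ˢ M.reach) (fun z r => r.act₀ = z.1) (fun z r => r.state = z.2)
    (p := fun z => M.P z.1 z.2) (fun z => M.P_nonneg _ _) (fun z => M.P_le_one _ _)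
    (fun z a ha h => M.condBern_state _ _ _ _)
    (L := 4 * Λ) (by linarith)).trans (hB.mul_failProb_le hB.card_univ_prod_reach_le hlen)
  have h55 : (5 : ℝ) / T + 5 / T ≤ 10 / T + 5 / T := by gcongr; norm_num
  refine (toOuterMeasure_bind_pure_le _ (rHat L h) (by positivity)
    (toOuterMeasure_not_and_le _ (by positivity) (by positivity) hP2 hR2) ?_).trans
    (ENNReal.ofReal_le_ofReal h55)
  rintro h' hh' ⟨hP2, hR2⟩ i
  refine ⟨fun b => ?_, fun hi b => ?_⟩
  · unfold rHat
    split_ifs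
    · exact ⟨freq_nonneg _ _ _, freq_le_one _ _ _⟩
    · exact ⟨freq_nonneg _ _ _, freq_le_one _ _ _⟩
  have hm := hB.one_le_m i
  have hWi := hWm i hi
  obtain ⟨hV1, hV2, -⟩ := hV i hi
  have hmΛ : Λ ≤ M.m i * Λ := le_mul_of_one_le_left (by linarith) hm
  have hmΛ' : (M.m i : ℝ) ≤ M.m i * Λ := le_mul_of_one_le_right (by linarith) hl
  have hmhat : (causalParam (qHat h i) : ℝ) ≤ 3 * M.m i := by exact_mod_cast hV2
  have hmhat1 : 1 ≤ causalParam (qHat h i) := one_le_causalParam hB.n_pos _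
  have hmhat1' : (1 : ℝ) ≤ causalParam (qHat h i) := by exact_mod_cast hmhat1
  unfold rHat
  by_cases hb : b ∈ L i
  · rw [if_pos hb]
    refine hkey _ _ i b hi (hR2 (i, b) (Finset.mem_product.2 ⟨hi, Finset.mem_univ _⟩)) ?_
    have hvis := (hWt i).trans (M.le_countP_state hh' (L := 4 * Λ) (by linarith) ht1
      (fun a hpos => by
        have h1 := hTP a i hpos
        calc 32 * (4 * Λ) ≤ 4000 * (M.m i * Λ) := by linarith
          _ = 96000 * (N * M.m i * Λ) / (24 * N) := by field_simp; ring
          _ ≤ T * M.P a i / (24 * N) := by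
              refine div_le_div_of_nonneg_right ?_ (by positivity)
              have : 0 ≤ N * M.m i * Λ := by positivity
              linarith
          _ = T / (24 * N) * M.P a i := by ring
          _ ≤ _ := mul_le_mul_of_nonneg_right (htN a) (M.P_nonneg a i))
      (fun a => hP2 (a, i) (Finset.mem_product.2 ⟨Finset.mem_univ _, hi⟩)))
    have hlenL : (L i).length = causalParam (qHat h i) := length_rareInterventions _
    have h1 := M.le_countP_roundRobin (nodup_rareInterventions _) hh' hb
    rw [hlenL] at h1
    have h2 : causalParam (qHat h i) ≤ h'.countP fun r => r.state = i := by
      have : (causalParam (qHat h i) : ℝ) ≤ (h'.countP fun r => r.state = i : ℕ) := by linarith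
      exact_mod_cast this
    -- Rounding down the visits divided by the list length costs a factor 2, and the length is at
    -- most `3mᵢ`.
    refine le_trans ?_ ((half_le_natDiv (by omega) h2).trans (by exact_mod_cast h1))
    rw [div_div _ (causalParam (qHat h i) : ℝ)]
    refine div_le_div₀ (Nat.cast_nonneg _) hvis (by positivity) (by linarith)
  · rw [if_neg hb]
    refine hkey _ _ i b hi (hR1 (i, b) (Finset.mem_product.2 ⟨hi, Finset.mem_univ _⟩)) ?_
    refine le_trans ?_ (le_countP_agrees (h := h) (c := fun r => r.state = i) (X := fun r => r.x) hb)
    change _ ≤ _ / ((causalParam (qHat h i) : ℝ) + 1)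
    exact div_le_div₀ (Nat.cast_nonneg _) ((hWt i).trans hV1) (by positivity) (by linarith)

/-! ### Comparison of exploration costs -/

/-- Working in `[0, ∞]` covers `v = 0` without a case split: then `w ≤ 0` and both sides are
infinite. -/
theorem rpow_neg_half_le {v w : ℝ} {β : ℝ} (hβ : 0 < β) (h : w ≤ β * v) :
    ENNReal.ofReal v ^ (-(1 / 2) : ℝ) ≤
      ENNReal.ofReal β ^ (1 / 2 : ℝ) * ENNReal.ofReal w ^ (-(1 / 2) : ℝ) := by
  have hβ0 : ENNReal.ofReal β ^ (1 / 2 : ℝ) ≠ 0 := by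
    rw [Ne, ENNReal.rpow_eq_zero_iff]
    simp [hβ]
  have hβt : ENNReal.ofReal β ^ (1 / 2 : ℝ) ≠ ⊤ :=
    ENNReal.rpow_ne_top_of_nonneg (by norm_num) ENNReal.ofReal_ne_top
  have h1 : ENNReal.ofReal w ^ (1 / 2 : ℝ) ≤
      ENNReal.ofReal β ^ (1 / 2 : ℝ) * ENNReal.ofReal v ^ (1 / 2 : ℝ) := by
    rw [← ENNReal.mul_rpow_of_nonneg _ _ (by norm_num), ← ENNReal.ofReal_mul hβ.le]
    gcongr
  rw [ENNReal.rpow_neg, ENNReal.rpow_neg]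
  calc (ENNReal.ofReal v ^ (1 / 2 : ℝ))⁻¹
      = ENNReal.ofReal β ^ (1 / 2 : ℝ) *
        (ENNReal.ofReal β ^ (1 / 2 : ℝ) * ENNReal.ofReal v ^ (1 / 2 : ℝ))⁻¹ := by
        rw [ENNReal.mul_inv (Or.inl hβ0) (Or.inl hβt), ← mul_assoc,
          ENNReal.mul_inv_cancel hβ0 hβt, one_mul]
    _ ≤ _ := by gcongr

/-- The cost increases with the weights `P √m` and decreases with the visit frequencies `Pᵀf`, so
constant-factor errors in these change it by a constant factor only. -/
theorem exploreCost_le {n k : ℕ} {P P' : Matrix (Intervention n) (Fin k) ℝ} {m m' : Fin k → ℕ}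
    {f f' : Intervention n → ℝ} {α β : ℝ} (hα : 0 ≤ α) (hβ : 0 < β)
    (h1 : ∀ a i, P a i * √(m i) ≤ α * (P' a i * √(m' i)))
    (h2 : ∀ i, (P'ᵀ *ᵥ f') i ≤ β * (Pᵀ *ᵥ f) i) :
    exploreCost P m f ≤
      ENNReal.ofReal α * ENNReal.ofReal β ^ (1 / 2 : ℝ) * exploreCost P' m' f' := by
  refine iSup_le fun a => ?_
  refine le_trans ?_ (mul_le_mul_right (le_iSup (fun a => ∑ i, ENNReal.ofReal (P' a i * √(m' i)) *
    ENNReal.ofReal ((P'ᵀ *ᵥ f') i) ^ (-(1 / 2) : ℝ)) a) _)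
  rw [Finset.mul_sum]
  refine Finset.sum_le_sum fun i _ => ?_
  calc _ ≤ (ENNReal.ofReal α * ENNReal.ofReal (P' a i * √(m' i))) *
        (ENNReal.ofReal β ^ (1 / 2 : ℝ) * ENNReal.ofReal ((P'ᵀ *ᵥ f') i) ^ (-(1 / 2) : ℝ)) := by
        refine mul_le_mul' ?_ (rpow_neg_half_le hβ (h2 i))
        rw [← ENNReal.ofReal_mul hα]
        exact ENNReal.ofReal_le_ofReal (h1 a i)
    _ = _ := by ring

theorem mulVec_le_mulVec {n k : ℕ} {P P' : Matrix (Intervention n) (Fin k) ℝ}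
    {f f' : Intervention n → ℝ} {β γ : ℝ} (hβ : 0 ≤ β) (hf : ∀ a, 0 ≤ f a)
    (hP' : ∀ a i, 0 ≤ P' a i) (hP : ∀ a i, P a i ≤ β * P' a i) (hff : ∀ a, f a ≤ γ * f' a)
    (i : Fin k) : (Pᵀ *ᵥ f) i ≤ β * γ * (P'ᵀ *ᵥ f') i := by
  simp only [Matrix.mulVec, dotProduct, Matrix.transpose_apply, Finset.mul_sum]
  refine Finset.sum_le_sum fun a _ => ?_
  calc P a i * f a ≤ β * P' a i * (γ * f' a) :=
        mul_le_mul (hP a i) (hff a) (hf a) (mul_nonneg hβ (hP' a i))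
    _ = _ := by ring

theorem TransGood.nonneg {n k : ℕ} {M : Model n k} {T : ℕ}
    {P' : Matrix (Intervention n) (Fin k) ℝ} (hP : TransGood M T P') (a : Intervention n)
    (i : Fin k) : 0 ≤ P' a i := by
  have := M.P_nonneg a i
  have := (hP a i).2.2.1
  linarith

theorem mul_sqrt_le {x y α : ℝ} {m m' : ℕ} {c : ℝ} (hy : 0 ≤ y) (hx : x ≤ 2 * y)
    (hm : (m : ℝ) ≤ c ^ 2 * m') (hc : 0 ≤ c) (hα : 2 * c = α) :
    x * √m ≤ α * (y * √m') := by
  have h1 : √(m : ℝ) ≤ c * √m' := by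
    rw [← Real.sqrt_sq hc, ← Real.sqrt_mul (sq_nonneg c)]
    exact Real.sqrt_le_sqrt hm
  calc x * √m ≤ 2 * y * (c * √m') := mul_le_mul hx h1 (Real.sqrt_nonneg _) (by positivity)
    _ = _ := by rw [← hα]; ring

/-- The chosen frequencies are nearly optimal for the true parameters. -/
theorem exploreCost_mixFreq_le {n k : ℕ} {M : Model n k} {T : ℕ} (S : Solver n k)
    {P' : Matrix (Intervention n) (Fin k) ℝ} {m' : Fin k → ℕ} {ft : Intervention n → ℝ}
    (hP : TransGood M T P') (hm : CausalGood M m') (hft : ft ∈ stdSimplex ℝ (Intervention n))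
    {g : Intervention n → ℝ} (hg : g ∈ stdSimplex ℝ (Intervention n)) :
    exploreCost M.P M.m (mixFreq (S.minmax P' m') ft) ^ 2 ≤
      ENNReal.ofReal 6912 * exploreCost M.P M.m g ^ 2 := by
  have hfs := S.minmax_mem P' m'
  set fs := S.minmax P' m'
  have h1 : exploreCost M.P M.m (mixFreq fs ft) ≤
      ENNReal.ofReal 6 * ENNReal.ofReal 6 ^ (1 / 2 : ℝ) * exploreCost P' m' fs := by
    -- `α = 2 · 3` from `P ≤ 2P'` and `√5 ≤ 3`; `β = 2 · 3` from `P' ≤ 2P` and the weight `1/3` of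
    -- `fs` in the mixture.
    refine exploreCost_le (by norm_num) (by norm_num) (fun a i => ?_) (fun i => ?_)
    · by_cases hi : i ∈ M.reach
      · have h5 : (M.m i : ℝ) ≤ 5 * m' i := by exact_mod_cast (hm i hi).2
        have h0 : (0 : ℝ) ≤ m' i := Nat.cast_nonneg _
        exact mul_sqrt_le (c := 3) (hP.nonneg a i) (hP a i).2.2.1 (by linarith) (by norm_num)
          (by norm_num)
      -- At unreachable states nothing is known about `m'`, but the estimated probabilities vanish
      -- there too.
      · rw [M.P_eq_zero hi a, (hP a i).1 (M.P_eq_zero hi a)]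
        simp
    · refine (mulVec_le_mulVec (f' := mixFreq fs ft) (β := 2) (γ := 3) (by norm_num) hfs.1 M.P_nonneg
        (fun a i => (hP a i).2.2.2) (fun a => ?_) i).trans_eq (by norm_num)
      have h2 := hft.1 a
      have h3 : (0 : ℝ) ≤ 1 / (2 * n + 1) := by positivity
      simp only [mixFreq]
      linarith
  have h2 : exploreCost P' m' g ≤
      ENNReal.ofReal 4 * ENNReal.ofReal 2 ^ (1 / 2 : ℝ) * exploreCost M.P M.m g := by
    -- `α = 2 · 2` from `P' ≤ 2P` and `√3 ≤ 2`; `β = 2` from `P ≤ 2P'`. Altogether `6² · 6 · 4² · 2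
    -- = 6912`.
    refine exploreCost_le (by norm_num) (by norm_num) (fun a i => ?_) (fun i => ?_)
    · by_cases hi : i ∈ M.reach
      · have h5 : (m' i : ℝ) ≤ 3 * M.m i := by exact_mod_cast (hm i hi).1
        have h0 : (0 : ℝ) ≤ M.m i := Nat.cast_nonneg _
        exact mul_sqrt_le (c := 2) (M.P_nonneg a i) (hP a i).2.2.2 (by linarith) (by norm_num)
          (by norm_num)
      · rw [M.P_eq_zero hi a, (hP a i).1 (M.P_eq_zero hi a)]
        simp
    · exact (mulVec_le_mulVec (f' := g) (β := 2) (γ := 1) (by norm_num) hg.1 hP.nonneg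
        (fun a i => (hP a i).2.2.1) (fun a => by simp) i).trans_eq (by norm_num)
  have hsq : ∀ x : ℝ, 0 ≤ x → (ENNReal.ofReal x ^ (1 / 2 : ℝ)) ^ 2 = ENNReal.ofReal x := by
    intro x hx
    rw [← ENNReal.rpow_natCast, ← ENNReal.rpow_mul]
    norm_num
  calc exploreCost M.P M.m (mixFreq fs ft) ^ 2
      ≤ (ENNReal.ofReal 6 * ENNReal.ofReal 6 ^ (1 / 2 : ℝ) *
        (ENNReal.ofReal 4 * ENNReal.ofReal 2 ^ (1 / 2 : ℝ) * exploreCost M.P M.m g)) ^ 2 := by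
        gcongr
        refine h1.trans (mul_le_mul_right ((S.minmax_opt P' m' g hg).trans h2) _)
    _ = ENNReal.ofReal 6 ^ 2 * (ENNReal.ofReal 6 ^ (1 / 2 : ℝ)) ^ 2 * ENNReal.ofReal 4 ^ 2 *
        (ENNReal.ofReal 2 ^ (1 / 2 : ℝ)) ^ 2 * exploreCost M.P M.m g ^ 2 := by ring
    _ = ENNReal.ofReal 6912 * exploreCost M.P M.m g ^ 2 := by
        rw [hsq 6 (by norm_num), hsq 2 (by norm_num), ← ENNReal.ofReal_pow (by norm_num),
          ← ENNReal.ofReal_pow (by norm_num), ← ENNReal.ofReal_mul (by norm_num),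
          ← ENNReal.ofReal_mul (by norm_num), ← ENNReal.ofReal_mul (by norm_num)]
        norm_num

theorem mixFreq_mulVec_pos {n k : ℕ} {M : Model n k} {fs ft : Intervention n → ℝ}
    (hfs : fs ∈ stdSimplex ℝ (Intervention n)) (hft : ft ∈ stdSimplex ℝ (Intervention n))
    {i : Fin k} (hi : i ∈ M.reach) : 0 < (M.Pᵀ *ᵥ mixFreq fs ft) i := by
  obtain ⟨a, ha⟩ := M.mem_reach.1 hi
  refine lt_of_lt_of_le (mul_pos ?_ ha) (le_mulVec M (mixFreq_mem hfs hft).1 a i)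
  have h1 := hfs.1 a
  have h2 := hft.1 a
  have h3 : (0 : ℝ) < 1 / (2 * n + 1) := by positivity
  simp only [mixFreq]
  linarith

/-- The uniform share gives every reachable state positive frequency, so the cost of the mixture is
finite. Hence the infimum defining `lam` is finite, `toReal` loses nothing, and the estimate passes
to real numbers. -/
theorem sum_div_sqrt_le {n k : ℕ} {M : Model n k} {T : ℕ} (S : Solver n k)
    {P' : Matrix (Intervention n) (Fin k) ℝ} {m' : Fin k → ℕ} {ft : Intervention n → ℝ}
    (hP : TransGood M T P') (hm : CausalGood M m') (hft : ft ∈ stdSimplex ℝ (Intervention n))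
    (a : Intervention n) :
    ∑ i, M.P a i * (√(M.m i) / √((M.Pᵀ *ᵥ mixFreq (S.minmax P' m') ft) i)) ≤
      √(6912 * M.lam) := by
  have hfs := S.minmax_mem P' m'
  have hmix := mixFreq_mem hfs hft
  have hcost := fun (g : Intervention n → ℝ) (hg : g ∈ stdSimplex ℝ (Intervention n)) =>
    exploreCost_mixFreq_le S hP hm hft hg
  have hpos := fun (i : Fin k) (hi : i ∈ M.reach) => mixFreq_mulVec_pos (M := M) hfs hft hi
  set f := mixFreq (S.minmax P' m') ft
  have hterm : ∀ a i, ENNReal.ofReal (M.P a i * √(M.m i)) *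
      ENNReal.ofReal ((M.Pᵀ *ᵥ f) i) ^ (-(1 / 2) : ℝ) =
      ENNReal.ofReal (M.P a i * (√(M.m i) / √((M.Pᵀ *ᵥ f) i))) := by
    intro a i
    by_cases hi : i ∈ M.reach
    · rw [ENNReal.ofReal_rpow_of_pos (hpos i hi),
        ← ENNReal.ofReal_mul (mul_nonneg (M.P_nonneg a i) (Real.sqrt_nonneg _)),
        Real.rpow_neg (hpos i hi).le, ← Real.sqrt_eq_rpow, mul_assoc, div_eq_mul_inv]
    · simp [M.P_eq_zero hi a]
  have hnn : ∀ a i, 0 ≤ M.P a i * (√(M.m i) / √((M.Pᵀ *ᵥ f) i)) := fun a i =>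
    mul_nonneg (M.P_nonneg a i) (by positivity)
  have hsum : ∀ a, ∑ i, ENNReal.ofReal (M.P a i * √(M.m i)) *
      ENNReal.ofReal ((M.Pᵀ *ᵥ f) i) ^ (-(1 / 2) : ℝ) =
      ENNReal.ofReal (∑ i, M.P a i * (√(M.m i) / √((M.Pᵀ *ᵥ f) i))) := fun a => by
    rw [ENNReal.ofReal_sum_of_nonneg fun i _ => hnn a i]
    exact Finset.sum_congr rfl fun i _ => hterm a i
  have hfin : exploreCost M.P M.m f ≠ ⊤ := by
    rw [exploreCost, ← Finset.sup_univ_eq_iSup]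
    refine ((Finset.sup_lt_iff ENNReal.zero_lt_top).2 fun a _ => ?_).ne
    rw [hsum]
    exact ENNReal.ofReal_lt_top
  have hI : (⨅ g ∈ stdSimplex ℝ (Intervention n), exploreCost M.P M.m g ^ 2) ≠ ⊤ :=
    ne_top_of_le_ne_top (ENNReal.pow_ne_top hfin) (iInf₂_le f hmix)
  have hle : exploreCost M.P M.m f ^ 2 ≤
      ENNReal.ofReal 6912 * ⨅ g ∈ stdSimplex ℝ (Intervention n), exploreCost M.P M.m g ^ 2 := by
    rw [mul_comm, ← ENNReal.div_le_iff_le_mul (by simp) (by simp)]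
    refine le_iInf₂ fun g hg => ?_
    rw [ENNReal.div_le_iff_le_mul (by simp) (by simp), mul_comm]
    exact hcost g hg
  refine Real.le_sqrt_of_sq_le ?_
  have h0 := Finset.sum_nonneg fun i (_ : i ∈ Finset.univ) => hnn a i
  have h1 : ENNReal.ofReal ((∑ i, M.P a i * (√(M.m i) / √((M.Pᵀ *ᵥ f) i))) ^ 2) ≤
      ENNReal.ofReal (6912 * M.lam) := by
    rw [ENNReal.ofReal_pow h0, ENNReal.ofReal_mul (by norm_num), Model.lam, ENNReal.ofReal_toReal hI]
    refine le_trans ?_ hle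
    gcongr
    rw [← hsum]
    exact le_iSup (fun a => ∑ i, ENNReal.ofReal (M.P a i * √(M.m i)) *
      ENNReal.ofReal ((M.Pᵀ *ᵥ f) i) ^ (-(1 / 2) : ℝ)) a
  exact (ENNReal.ofReal_le_ofReal_iff (mul_nonneg (by norm_num) ENNReal.toReal_nonneg)).1 h1

/-! ### The suboptimality of the returned policy -/

/-- The policy is optimal for the estimates, and replacing estimates by true values costs at most `D
+ E`, once for the optimum and once for the policy. Reward errors are weighted by the true `P`, so
unreachable states are harmless; transition errors are weighted by `R' ∈ [0, 1]`. -/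
theorem subopt_le_of_estimates {n k : ℕ} (M : Model n k)
    {P' : Matrix (Intervention n) (Fin k) ℝ} {R' : Fin k → Intervention n → ℝ} {Δ : Fin k → ℝ}
    {D E : ℝ} (hR' : ∀ i b, 0 ≤ R' i b ∧ R' i b ≤ 1)
    (hD : ∀ a, ∑ i, |P' a i - M.P a i| ≤ D) (hE : ∀ a, ∑ i, M.P a i * Δ i ≤ E)
    (hΔ : ∀ i ∈ M.reach, ∀ b, |R' i b - M.meanReward i b| ≤ Δ i)
    {π : Policy n k} (hπ : ∀ i b, R' i b ≤ R' i (π.2 i))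
    (hπ₀ : ∀ a, ∑ i, P' a i * R' i (π.2 i) ≤ ∑ i, P' π.1 i * R' i (π.2 i)) :
    M.subopt π ≤ 2 * D + 2 * E := by
  have hPR : ∀ a i (x y : ℝ), (i ∈ M.reach → x ≤ y + Δ i) →
      M.P a i * x ≤ M.P a i * y + M.P a i * Δ i := by
    intro a i x y h
    by_cases hi : i ∈ M.reach
    · rw [← mul_add]
      exact mul_le_mul_of_nonneg_left (h hi) (M.P_nonneg a i)
    · simp [M.P_eq_zero hi a]
  have hJ : ∀ a, |∑ i, P' a i * R' i (π.2 i) - ∑ i, M.P a i * R' i (π.2 i)| ≤ D := by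
    intro a
    rw [← Finset.sum_sub_distrib]
    refine (Finset.abs_sum_le_sum_abs _ _).trans ((Finset.sum_le_sum fun i _ => ?_).trans (hD a))
    rw [← sub_mul, abs_mul, abs_of_nonneg (hR' i _).1]
    exact mul_le_of_le_one_right (abs_nonneg _) (hR' i _).2
  have hopt : M.optValue ≤ ∑ i, P' π.1 i * R' i (π.2 i) + D + E := by
    refine ciSup_le fun a => ?_
    have h1 : ∑ i, M.P a i * ⨆ b, M.meanReward i b ≤
        ∑ i, (M.P a i * R' i (π.2 i) + M.P a i * Δ i) := by
      refine Finset.sum_le_sum fun i _ => hPR a i _ _ fun hi => ciSup_le fun b => ?_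
      have h2 := (abs_le.1 (hΔ i hi b)).1
      have h3 := hπ i b
      linarith
    rw [Finset.sum_add_distrib] at h1
    have h4 := (abs_le.1 (hJ a)).1
    have h5 := hπ₀ a
    have h6 := hE a
    linarith
  have hval : ∑ i, M.P π.1 i * R' i (π.2 i) ≤ M.value π + E := by
    have h1 : ∑ i, M.P π.1 i * R' i (π.2 i) ≤
        ∑ i, (M.P π.1 i * M.meanReward i (π.2 i) + M.P π.1 i * Δ i) := by
      refine Finset.sum_le_sum fun i _ => hPR _ i _ _ fun hi => ?_
      have h2 := (abs_le.1 (hΔ i hi (π.2 i))).2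
      linarith
    rw [Finset.sum_add_distrib] at h1
    have h2 := hE π.1
    simp only [Model.value]
    linarith
  have h4 := (abs_le.1 (hJ π.1)).2
  rw [Model.subopt]
  linarith

theorem subopt_le_one {n k : ℕ} (M : Model n k) (π : Policy n k) : M.subopt π ≤ 1 := by
  have h1 : M.optValue ≤ 1 := by
    refine ciSup_le fun a => ?_
    rw [← M.sum_P a]
    exact Finset.sum_le_sum fun i _ => mul_le_of_le_one_right (M.P_nonneg a i)
      (ciSup_le fun b => M.meanReward_le_one i b)
  have h2 : 0 ≤ M.value π :=
    Finset.sum_nonneg fun i _ => mul_nonneg (M.P_nonneg _ i) (M.meanReward_nonneg i _)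
  rw [Model.subopt]
  linarith

/-- The rate of the regret bound. -/
def regretRate {n k : ℕ} (M : Model n k) (T : ℕ) : ℝ :=
  √(max M.lam ((M.m₀ : ℝ) / M.pPlus) * logNT n T / T)

theorem subopt_le_of_good {n k : ℕ} {M : Model n k} {T : ℕ} (hB : Budget M T) (S : Solver n k)
    {P' : Matrix (Intervention n) (Fin k) ℝ} {m' : Fin k → ℕ} {R' : Fin k → Intervention n → ℝ}
    (hP : TransGood M T P') (hm : CausalGood M m')
    (hR : RewardGood M T (mixFreq (S.minmax P' m') (S.maxmin P')) R') :
    M.subopt (S.argmax fun a => ∑ i, P' a i * R' i (S.argmax (R' i)), fun i => S.argmax (R' i)) ≤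
      10000 * regretRate M T := by
  have hl := hB.one_le_log
  have hm₀ := hB.one_le_m₀
  have hp := M.pPlus_pos
  have hT0 : (0 : ℝ) < T := by exact_mod_cast hB.T_pos
  have hsum := sum_div_sqrt_le S hP hm (S.maxmin_mem P')
  set f := mixFreq (S.minmax P' m') (S.maxmin P')
  have hD : ∀ a, ∑ i, |P' a i - M.P a i| ≤ 30 * regretRate M T := by
    intro a
    calc ∑ i, |P' a i - M.P a i|
        ≤ ∑ i, 2 * √(192 * M.m₀ * logNT n T / T) * √(M.P a i) := by
          refine Finset.sum_le_sum fun i _ => ((hP a i).2.1).trans_eq ?_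
          rw [mul_assoc 2, ← Real.sqrt_mul (by positivity)]
          congr 2; ring
      _ = 2 * √(192 * M.m₀ * logNT n T / T) * ∑ i, √(M.P a i) := by rw [Finset.mul_sum]
      _ ≤ 2 * √(192 * M.m₀ * logNT n T / T) * (1 / √M.pPlus) := by
          gcongr; exact M.sum_sqrt_P_le a
      _ = 2 * √(192 * (M.m₀ / M.pPlus * logNT n T / T)) := by
          rw [mul_assoc, mul_one_div, ← Real.sqrt_div (by positivity)]
          congr 2; field_simp
      -- `192 ≤ 15²`.
      _ ≤ 2 * √(15 ^ 2 * (max M.lam ((M.m₀ : ℝ) / M.pPlus) * logNT n T / T)) := by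
          gcongr
          · norm_num
          · exact le_max_right _ _
      _ = 30 * regretRate M T := by
          rw [Real.sqrt_mul (by norm_num), Real.sqrt_sq (by norm_num), regretRate]; ring
  have hE : ∀ a, ∑ i, M.P a i * (2 * √(768 * M.m i * logNT n T / (T * (M.Pᵀ *ᵥ f) i))) ≤
      4800 * regretRate M T := by
    intro a
    calc ∑ i, M.P a i * (2 * √(768 * M.m i * logNT n T / (T * (M.Pᵀ *ᵥ f) i)))
        = 2 * √(768 * logNT n T / T) * ∑ i, M.P a i * (√(M.m i) / √((M.Pᵀ *ᵥ f) i)) := by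
          rw [Finset.mul_sum]
          refine Finset.sum_congr rfl fun i _ => ?_
          rw [show 768 * M.m i * logNT n T / (T * (M.Pᵀ *ᵥ f) i) =
            (768 * logNT n T / T) * (M.m i / (M.Pᵀ *ᵥ f) i) by rw [div_mul_div_comm]; ring,
            Real.sqrt_mul (by positivity), Real.sqrt_div (Nat.cast_nonneg _)]
          ring
      _ ≤ 2 * √(768 * logNT n T / T) * √(6912 * M.lam) := by gcongr; exact hsum a
      -- `768 · 6912 = 2304²`.
      _ = 2 * √(2304 ^ 2 * (M.lam * logNT n T / T)) := by
          rw [mul_assoc, ← Real.sqrt_mul (by positivity)]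
          congr 2; ring
      _ ≤ 2 * √(2400 ^ 2 * (max M.lam ((M.m₀ : ℝ) / M.pPlus) * logNT n T / T)) := by
          have : 0 ≤ M.lam := ENNReal.toReal_nonneg
          gcongr
          · norm_num
          · exact le_max_left _ _
      _ = 4800 * regretRate M T := by
          rw [Real.sqrt_mul (by norm_num), Real.sqrt_sq (by norm_num), regretRate]; ring
  refine (subopt_le_of_estimates M (fun i => (hR i).1) hD hE (fun i hi => (hR i).2 hi)
    (fun i b => S.argmax_opt (R' i) b)
    (fun a => S.argmax_opt (fun a => ∑ i, P' a i * R' i (S.argmax (R' i))) a)).trans ?_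
  have : 0 ≤ regretRate M T := Real.sqrt_nonneg _
  linarith

/-! ### From the good event to the expected regret -/

theorem algCE_good {n k : ℕ} {M : Model n k} {T : ℕ} (hB : Budget M T) (S : Solver n k) :
    (algCE M S T).toOuterMeasure {π | ¬ M.subopt π ≤ 10000 * regretRate M T} ≤
      ENNReal.ofReal (55 / T) := by
  rw [show (55 : ℝ) / T = 15 / T + (10 / T + 30 / T) by ring]
  refine toOuterMeasure_bind_le_add _ _ (by positivity) (by positivity)
    (estimateTransitions_good hB) fun P' _ hP => ?_
  refine toOuterMeasure_bind_le_add _ _ (by positivity) (by positivity)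
    (estimateCausalParams_good hB (S.maxmin_mem P')) fun m' _ hm => ?_
  exact toOuterMeasure_bind_pure_le _ (fun R' : Fin k → Intervention n → ℝ =>
    ((S.argmax fun a => ∑ i, P' a i * R' i (S.argmax (R' i)), fun i => S.argmax (R' i)) :
      Policy n k)) (by positivity)
    (estimateRewards_good hB (S.minmax_mem P' m') (S.maxmin_mem P'))
    fun R' _ hR => subopt_le_of_good hB S hP hm hR

/-- The failure event costs at most `55/T`. Since `m₀/p₊ ≥ 1` and `log(NT) ≥ 1`, the rate is at
least `1/√T ≥ 1/T` and absorbs this. -/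
theorem regret_le {n k : ℕ} {M : Model n k} {T : ℕ} (hB : Budget M T) (S : Solver n k) :
    regret M S T ≤ 10055 * regretRate M T := by
  classical
  have hT1 : (1 : ℝ) ≤ T := by exact_mod_cast hB.T_pos
  have hrate : 0 ≤ regretRate M T := Real.sqrt_nonneg _
  set p := algCE M S T with hp
  have hsum1 : ∑ π, (p π).toReal = 1 := by
    rw [← ENNReal.toReal_sum fun π _ => PMF.apply_ne_top _ _,
      (tsum_fintype (fun π => p π)).symm.trans (PMF.tsum_coe _), ENNReal.toReal_one]
  have hbad : ∑ π, (if M.subopt π ≤ 10000 * regretRate M T then 0 else (p π).toReal) ≤ 55 / T := by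
    have h1 := algCE_good hB S
    rw [PMF.toOuterMeasure_apply, tsum_fintype] at h1
    have h2 := ENNReal.toReal_mono ENNReal.ofReal_ne_top h1
    rw [ENNReal.toReal_ofReal (by positivity), ENNReal.toReal_sum fun π _ => ?_] at h2
    · refine le_trans (le_of_eq (Finset.sum_congr rfl fun π _ => ?_)) h2
      by_cases h : M.subopt π ≤ 10000 * regretRate M T <;>
        simp [Set.indicator, h, hp, -not_le]
    · exact ne_top_of_le_ne_top (PMF.apply_ne_top p π) (Set.indicator_le_self _ _ π)
  have hT : 55 / T ≤ 55 * regretRate M T := by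
    rw [div_eq_mul_one_div]
    gcongr
    refine Real.le_sqrt_of_sq_le ?_
    have h1 : 1 ≤ max M.lam ((M.m₀ : ℝ) / M.pPlus) := by
      refine le_trans ?_ (le_max_right _ _)
      rw [one_le_div M.pPlus_pos]
      exact M.pPlus_le_one.trans hB.one_le_m₀
    have h2 := hB.one_le_log
    have h3 : 1 ≤ max M.lam ((M.m₀ : ℝ) / M.pPlus) * logNT n T := one_le_mul_of_one_le_of_one_le h1 h2
    calc (1 / (T : ℝ)) ^ 2 = 1 / T / T := by ring
      _ ≤ 1 / T := div_le_self (by positivity) hT1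
      _ ≤ _ := by gcongr
  calc regret M S T
      ≤ ∑ π, ((p π).toReal * (10000 * regretRate M T) +
        if M.subopt π ≤ 10000 * regretRate M T then 0 else (p π).toReal) := by
        refine Finset.sum_le_sum fun π _ => ?_
        have h0 : 0 ≤ (p π).toReal := ENNReal.toReal_nonneg
        split_ifs with h
        · rw [add_zero]
          exact mul_le_mul_of_nonneg_left h h0
        · have h1 := mul_le_of_le_one_right h0 (subopt_le_one M π)
          have h2 : 0 ≤ (p π).toReal * (10000 * regretRate M T) := by positivity
          linarith
    _ = 10000 * regretRate M T +
        ∑ π, if M.subopt π ≤ 10000 * regretRate M T then 0 else (p π).toReal := by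
        rw [Finset.sum_add_distrib, ← Finset.sum_mul, hsum1, one_mul]
    _ ≤ _ := by linarith

/-- The argument needs only the first power of `1/p₊`, and `p₊³ ≤ p₊`. -/
theorem budget_of_le {n k : ℕ} (hn : 1 ≤ n) {M : Model n k} {T : ℕ} (hT : 1 ≤ T)
    (h : 100000 * (((2 * n + 1 : ℕ) : ℝ) * ((Finset.univ.sup M.m : ℕ) : ℝ) / M.pPlus ^ 3) *
      Real.log (2 * ((2 * n + 1 : ℕ) : ℝ) * (T : ℝ)) ≤ (T : ℝ)) : Budget M T := by
  refine ⟨hn, hT, fun i => ?_⟩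
  have hp := M.pPlus_pos
  have hp1 := M.pPlus_le_one
  have hT1 : (1 : ℝ) ≤ T := by exact_mod_cast hT
  have hN : (1 : ℝ) ≤ ((2 * n + 1 : ℕ) : ℝ) := by exact_mod_cast (show 1 ≤ 2 * n + 1 by omega)
  set N : ℝ := ((2 * n + 1 : ℕ) : ℝ)
  have hm : (M.m i : ℝ) ≤ ((Finset.univ.sup M.m : ℕ) : ℝ) := by
    exact_mod_cast Finset.le_sup (f := M.m) (Finset.mem_univ i)
  have hlog0 : 0 ≤ logNT n T := Real.log_nonneg (one_le_mul_of_one_le_of_one_le hN hT1)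
  have hlog : logNT n T ≤ Real.log (2 * N * T) := by
    refine Real.log_le_log (by positivity) ?_
    change N * T ≤ 2 * N * T
    have : 0 ≤ N * T := by positivity
    linarith
  have hp3 : M.pPlus ^ 3 ≤ M.pPlus := pow_le_of_le_one hp.le hp1 (by norm_num)
  calc 100000 * (N * M.m i * logNT n T)
      ≤ 100000 * (N * ((Finset.univ.sup M.m : ℕ) : ℝ) * Real.log (2 * N * T)) := by gcongr
    _ = 100000 * (N * ((Finset.univ.sup M.m : ℕ) : ℝ) / M.pPlus ^ 3) *
        Real.log (2 * N * T) * M.pPlus ^ 3 := by field_simp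
    _ ≤ T * M.pPlus ^ 3 := by gcongr
    _ ≤ T * M.pPlus := by gcongr

end

end CausalMDP

theorem theorem1 :
    ∃ C₀ C : ℝ, 0 < C₀ ∧ 0 < C ∧
      ∀ (n k : ℕ), 1 ≤ n → ∀ (M : CausalMDP.Model n k) (S : CausalMDP.Solver n k) (T : ℕ), 1 ≤ T →
        C₀ * (((2 * n + 1 : ℕ) : ℝ) * ((Finset.univ.sup M.m : ℕ) : ℝ) / M.pPlus ^ 3) *
            Real.log (2 * ((2 * n + 1 : ℕ) : ℝ) * (T : ℝ)) ≤ (T : ℝ) →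
        CausalMDP.regret M S T ≤
          C * √(max M.lam ((M.m₀ : ℝ) / M.pPlus) *
            Real.log (((2 * n + 1 : ℕ) : ℝ) * (T : ℝ)) / (T : ℝ)) :=
  ⟨100000, 10055, by norm_num, by norm_num, fun _ _ hn _ S _ hT h =>
    CausalMDP.regret_le (CausalMDP.budget_of_le hn hT h) S⟩
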